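/- Let $G$ be a second countable locally compact (Hausdorff) group, let $\mathcal H$ be a real affine Hilbert space with separable tangent space $\mathcal H^0$, and let $\alpha : G \curvearrowright \mathcal H$ be an affine isometric action (a homomorphism $G\to\mathrm{Isom}(\mathcal H)$ with continuous orbit maps). Let $\alpha^0 : G\curvearrowright \mathcal H^0$ be its linear part. For $t>0$ let $\mathcal H^t=\{tx : x\in\mathcal H\}$ be the affine Hilbert space with tangent space $\mathcal H^0$ in which $tx-ty=t(x-y)$, and let $\alpha^t: G\curvearrowright\mathcal H^t$ be given by $\alpha^t_g(tx)=t\,\alpha_g(x)$; for $t=0$ the action is $\alpha^0$ on $\mathcal H^0$. A Gaussian density over an affine Hilbert space $\mathcal K$ is a family of equivalent probability measures $(m_y)_{y\in\mathcal K}$ on a standard Borel space $X$ with a linear map $f\mapsto\widehat f$ from continuous affine functions on $\mathcal K$ to random variables on $X$ modulo null sets, such that $\widehat f$ has law $\mathcal N(f(y),\|f^0\|^2)$ under $m_y$ for all $y$ (where $f^0$ is the linear part of $f$), and the $\widehat f$ generate the $\sigma$-algebra modulo null sets. The Gaussian action $\widehat\beta$ of an affine isometric action $\beta:G\curvearrowright\mathcal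 K$ is the nonsingular action on $X$ with $(\widehat\beta_g)_*m_y=m_{\beta_g y}$ for all $g,y$; it exists and is unique up to isomorphism. Write $\widehat\alpha^t$ for the Gaussian action of $\alpha^t$. For a symmetric probability measure $\mu$ on $G$ and an orthogonal representation $\pi$ of $G$, put $\rho_\mu(\pi)=\left\|\int_G\pi(g)\,d\mu(g)\right\|$ (operator norm of the weak integral). Let $\rho_\mu(G)=\rho_\mu(\lambda_G)$ for the left regular representation $\lambda_G$ on $L^2(G)$, and for a nonsingular action $\sigma$ on $(X,\nu)$ let $\rho_\mu(\sigma)=\rho_\mu(\pi_\sigma)$ for the Koopman representation $(\pi_\sigma(g)h)(\omega)=\left(\frac{d g_*\nu}{d\nu}(\omega)\right)^{1/2}h(g^{-1}\omega)$ on $L^2(X,\nu)$. Let $\|\alpha\|_\mu^2=\inf_{x\in\mathcal H}\int_G\|gx-x\|^2\,d\mu(g)\in[0,\infty]$. **Theorem.** Let $\mu$ be a symmetric probability measure on $G$, let $x\in\mathcal H$, and let $b(g)=gx-x$. Let $(g_n)$ be the $\mu$-random walk on $G$ (so $g_n$ is a product of $n$ independent elements of law $\mu$). Then for every $s\ge 0$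 the limit $$f(s)=\lim_{n\to\infty}\mathbb E\left(e^{-s\|b(g_n)\|^2}\right)^{1/n}$$ exists and lies in $(0,1]$, and: (i) for all $t\ge0$, $\rho_\mu(\widehat\alpha^t)=f(t^2/8)$; (ii) for all $s\ge0$, $f(s)\ge\rho_\mu(G)$ and $f(s)\ge e^{-s\|\alpha\|_\mu^2}$ (the last bound being void if $\|\alpha\|_\mu^2=\infty$); (iii) $f$ is continuous and decreasing (non-increasing) on $[0,\infty)$, and $\log f$ is convex on $[0,\infty)$. -/

import Mathlib

open MeasureTheory ProbabilityTheory Filter Topology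
open scoped ENNReal NNReal RealInnerProductSpace

universe w

noncomputable section

/-! ### Inflations of an affine Hilbert space -/

/-- The inflation `𝓗ᵗ` of an affine Hilbert space `𝓗` by a factor `t > 0`. The point `⟨x⟩` is the
one written `t x`; the tangent space is unchanged and `t x - t y = t (x - y)`. -/
@[ext]
structure Inflation (t : {t : ℝ // 0 < t}) (P : Type*) where
  pt : P

namespace Inflation

variable {V P : Type*} [NormedAddCommGroup V] [InnerProductSpace ℝ V] [MetricSpace P]
  [NormedAddTorsor V P] (t : {t : ℝ // 0 < t})

instance : MetricSpace (Inflation t P) where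
  dist x y := t.1 * dist x.pt y.pt
  dist_self x := by simp
  dist_comm x y := by simp [dist_comm]
  dist_triangle x y z := by
    rw [← mul_add]
    exact mul_le_mul_of_nonneg_left (dist_triangle _ _ _) t.2.le
  eq_of_dist_eq_zero := by
    intro x y h
    have h' : dist x.pt y.pt = 0 := (mul_eq_zero.1 h).resolve_left t.2.ne'
    exact Inflation.ext (dist_eq_zero.1 h')

instance : NormedAddTorsor V (Inflation t P) where
  vadd v x := ⟨(t.1⁻¹ • v) +ᵥ x.pt⟩
  zero_vadd x := Inflation.ext (by
    change (t.1⁻¹ • (0 : V)) +ᵥ x.pt = x.pt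
    simp)
  add_vadd v w x := Inflation.ext (by
    change (t.1⁻¹ • (v + w)) +ᵥ x.pt = (t.1⁻¹ • v) +ᵥ ((t.1⁻¹ • w) +ᵥ x.pt)
    rw [smul_add, add_vadd])
  vsub x y := t.1 • (x.pt -ᵥ y.pt)
  nonempty := ⟨⟨(AddTorsor.nonempty (G := V) (P := P)).some⟩⟩
  vsub_vadd' x y := Inflation.ext (by
    change (t.1⁻¹ • t.1 • (x.pt -ᵥ y.pt)) +ᵥ y.pt = x.pt
    rw [inv_smul_smul₀ t.2.ne', vsub_vadd])
  vadd_vsub' v x := by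
    change t.1 • (((t.1⁻¹ • v) +ᵥ x.pt) -ᵥ x.pt) = v
    rw [vadd_vsub, smul_inv_smul₀ t.2.ne']
  dist_eq_norm' x y := by
    change t.1 * dist x.pt y.pt = ‖t.1 • (x.pt -ᵥ y.pt)‖
    rw [norm_smul, Real.norm_of_nonneg t.2.le, dist_eq_norm_vsub V]

theorem vadd_pt (v : V) (x : Inflation t P) : (v +ᵥ x).pt = (t.1⁻¹ • v) +ᵥ x.pt := rfl

theorem dist_eq (x y : Inflation t P) : dist x y = t.1 * dist x.pt y.pt := rfl

/-- The isometry `gᵗ` of `𝓗ᵗ` given by `gᵗ (t x) = t (g x)`. -/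
def isom (g : P ≃ᵃⁱ[ℝ] P) : Inflation t P ≃ᵃⁱ[ℝ] Inflation t P where
  toFun x := ⟨g x.pt⟩
  invFun x := ⟨g.symm x.pt⟩
  left_inv x := by simp
  right_inv x := by simp
  linear := g.linear
  map_vadd' x v := Inflation.ext (by
    change g (v +ᵥ x).pt = (t.1⁻¹ • g.linear v) +ᵥ g x.pt
    rw [vadd_pt]
    have h := g.toAffineEquiv.map_vadd x.pt (t.1⁻¹ • v)
    rw [map_smul] at h
    exact h)
  norm_map := g.norm_map

theorem isom_pt (g : P ≃ᵃⁱ[ℝ] P) (x : Inflation t P) : (isom t g x).pt = g x.pt := rfl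

end Inflation

/-! ### Affine isometric actions -/

/-- An affine isometric action of a topological group `G` on an affine Hilbert space `P`: a group
homomorphism to the isometry group, continuous for the topology of pointwise convergence. -/
structure AffineIsometricAction (G : Type*) {V : Type*} (P : Type*) [Group G] [TopologicalSpace G]
    [NormedAddCommGroup V] [InnerProductSpace ℝ V] [MetricSpace P] [NormedAddTorsor V P] where
  hom : G →* (P ≃ᵃⁱ[ℝ] P)
  continuous_orbit : ∀ x : P, Continuous fun g => hom g x

namespace AffineIsometricAction

variable {G V P : Type*} [Group G] [TopologicalSpace G] [NormedAddCommGroup V]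
  [InnerProductSpace ℝ V] [MetricSpace P] [NormedAddTorsor V P]

/-- The cocycle `b(g) = g x - x`. -/
def cocycle (α : AffineIsometricAction G P) (x : P) (g : G) : V := α.hom g x -ᵥ x

/-- The inflated action `αᵗ` on `𝓗ᵗ`, for `t > 0`. -/
def inflate (α : AffineIsometricAction G P) (t : {t : ℝ // 0 < t}) :
    AffineIsometricAction G (Inflation t P) where
  hom :=
    { toFun := fun g => Inflation.isom t (α.hom g)
      map_one' := by
        ext x
        simp [Inflation.isom_pt]
      map_mul' := fun g h => by
        ext x
        simp [Inflation.isom_pt] }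
  continuous_orbit x := by
    rw [continuous_iff_continuousAt]
    intro g
    have h : Tendsto (fun k => t.1 * dist (α.hom k x.pt) (α.hom g x.pt)) (𝓝 g) (𝓝 (t.1 * 0)) :=
      ((tendsto_iff_dist_tendsto_zero).1 ((α.continuous_orbit x.pt).tendsto g)).const_mul _
    rw [mul_zero] at h
    exact (tendsto_iff_dist_tendsto_zero).2 h

theorem linear_apply (g : P ≃ᵃⁱ[ℝ] P) (v : V) (x : P) :
    g.linearIsometryEquiv v = g (v +ᵥ x) -ᵥ g x := by
  rw [AffineIsometryEquiv.map_vadd, vadd_vsub]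

/-- The linear part `α⁰`, an affine isometric action on the tangent space. -/
def linearPart (α : AffineIsometricAction G P) : AffineIsometricAction G V where
  hom :=
    { toFun := fun g => (α.hom g).linearIsometryEquiv.toAffineIsometryEquiv
      map_one' := by
        ext v
        have x : P := (AddTorsor.nonempty (G := V) (P := P)).some
        change (α.hom 1).linearIsometryEquiv v = v
        rw [linear_apply _ v x, map_one, AffineIsometryEquiv.coe_one, id, id, vadd_vsub]
      map_mul' := fun g h => by
        ext v
        have x : P := (AddTorsor.nonempty (G := V) (P := P)).some
        change (α.hom (g * h)).linearIsometryEquiv v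
          = (α.hom g).linearIsometryEquiv ((α.hom h).linearIsometryEquiv v)
        rw [linear_apply _ v x, linear_apply (α.hom g) _ (α.hom h x), linear_apply _ v x,
          map_mul, vsub_vadd]
        rfl }
  continuous_orbit v := by
    have x : P := (AddTorsor.nonempty (G := V) (P := P)).some
    change Continuous fun g => (α.hom g).linearIsometryEquiv v
    simp only [linear_apply _ v x]
    exact (α.continuous_orbit _).vsub (α.continuous_orbit _)

/-- The square `‖α‖_μ²` of the `μ`-harmonic seminorm, with values in `[0, ∞]`. -/
def harmonicSq [MeasurableSpace G] (α : AffineIsometricAction G P) (μ : Measure G) : ℝ≥0∞ :=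
  ⨅ x : P, ∫⁻ g, ENNReal.ofReal (‖α.cocycle x g‖ ^ 2) ∂μ

end AffineIsometricAction

/-! ### Random walks -/

/-- Position after `n` steps of the random walk with increments `ω 0, ω 1, …`. -/
def walk {G : Type*} [Group G] (n : ℕ) (ω : ℕ → G) : G := ((List.range n).map ω).prod

/-- The expectation of `F (g_n)` where `(g_n)` is the `μ`-random walk, i.e. the increments are
independent with law `μ`. -/
def walkExpectation {G : Type*} [Group G] [MeasurableSpace G] (μ : Measure G) (n : ℕ)
    (F : G → ℝ) : ℝ :=
  ∫ ω, F (walk n ω) ∂(Measure.infinitePi fun _ : ℕ => μ)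

/-! ### The `μ`-spectral radius of a representation -/

/-- `HasSpectralRadius U μ r` says that the averaged operator `P = ∫ U g dμ(g)` exists
(as a weak integral) and that its operator norm is `r`. The operator `P` is unique. -/
def HasSpectralRadius {G H : Type*} [MeasurableSpace G] [NormedAddCommGroup H]
    [InnerProductSpace ℝ H] (U : G → H →L[ℝ] H) (μ : Measure G) (r : ℝ) : Prop :=
  ∃ P : H →L[ℝ] H,
    (∀ ξ η : H, Integrable (fun g => ⟪U g ξ, η⟫) μ ∧ ⟪P ξ, η⟫ = ∫ g, ⟪U g ξ, η⟫ ∂μ) ∧ ‖P‖ = r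

/-- The left regular representation `(λ_g ξ)(h) = ξ (g⁻¹ h)` on `L²(G)` (left Haar measure). -/
def leftRegular (G : Type*) [Group G] [TopologicalSpace G] [IsTopologicalGroup G]
    [LocallyCompactSpace G] [SecondCountableTopology G] [MeasurableSpace G] [BorelSpace G]
    (g : G) :
    Lp ℝ 2 (Measure.haar : Measure G) →L[ℝ] Lp ℝ 2 (Measure.haar : Measure G) :=
  (Lp.compMeasurePreservingₗᵢ ℝ (fun h => g⁻¹ * h)
    (measurePreserving_mul_left Measure.haar g⁻¹)).toContinuousLinearMap

/-! ### Nonsingular actions and their Koopman representations -/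

/-- A nonsingular action of `G` on the measure class of `ν`: a homomorphism, up to null sets, to
the nonsingular automorphisms, continuous for the topology of `Aut(X)` in which `θ → id` means that
`‖θ_* η - η‖ → 0` for all probability measures `η ≪ ν`. -/
structure NonsingularAction (G X : Type*) [Group G] [TopologicalSpace G] [MeasurableSpace X]
    (ν : Measure X) where
  act : G → X → X
  quasi : ∀ g, Measure.QuasiMeasurePreserving (act g) ν ν
  one_ae : ∀ᵐ ω ∂ν, act 1 ω = ω
  mul_ae : ∀ g h, ∀ᵐ ω ∂ν, act (g * h) ω = act g (act h ω)
  continuous_at_one : ∀ η : Measure X, IsProbabilityMeasure η → η ≪ ν → ∀ ε : ℝ, 0 < ε →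
    ∀ᶠ g in 𝓝 (1 : G), ∀ S, MeasurableSet S → |(η.map (act g)).real S - η.real S| ≤ ε

namespace NonsingularAction

variable {G X : Type*} [Group G] [TopologicalSpace G] [MeasurableSpace X] {ν : Measure X}

/-- `(d(g_* ν)/dν)^{1/2} (ω) · h (g⁻¹ ω)`. -/
def koopmanFun (A : NonsingularAction G X ν) (g : G) (h : X → ℝ) (ω : X) : ℝ :=
  Real.sqrt (((ν.map (A.act g)).rnDeriv ν ω).toReal) * h (A.act g⁻¹ ω)

theorem koopmanFun_congr (A : NonsingularAction G X ν) (g : G) {h k : X → ℝ} (hk : h =ᵐ[ν] k) :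
    A.koopmanFun g h =ᵐ[ν] A.koopmanFun g k := by
  filter_upwards [(A.quasi g⁻¹).ae_eq_comp hk] with ω hω
  simp only [Function.comp] at hω
  simp [koopmanFun, hω]

theorem aestronglyMeasurable_koopmanFun (A : NonsingularAction G X ν) (g : G) {h : X → ℝ}
    (hh : AEStronglyMeasurable h ν) : AEStronglyMeasurable (A.koopmanFun g h) ν :=
  ((Measure.measurable_rnDeriv _ _).ennreal_toReal.sqrt.aestronglyMeasurable).mul
    (hh.comp_quasiMeasurePreserving (A.quasi g⁻¹))

variable [IsProbabilityMeasure ν]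

theorem eLpNorm_koopmanFun (A : NonsingularAction G X ν) (g : G) {h : X → ℝ}
    (hh : AEStronglyMeasurable h ν) : eLpNorm (A.koopmanFun g h) 2 ν = eLpNorm h 2 ν := by
  have : IsProbabilityMeasure (ν.map (A.act g)) :=
    Measure.isProbabilityMeasure_map (A.quasi g).measurable.aemeasurable
  have hm : AEMeasurable (fun ω => ‖h (A.act g⁻¹ ω)‖ₑ ^ (2 : ℝ)) ν :=
    ((hh.comp_quasiMeasurePreserving (A.quasi g⁻¹)).enorm).pow_const _
  have key : ∫⁻ ω, ‖A.koopmanFun g h ω‖ₑ ^ (2 : ℝ) ∂ν = ∫⁻ ω, ‖h ω‖ₑ ^ (2 : ℝ) ∂ν := by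
    calc ∫⁻ ω, ‖A.koopmanFun g h ω‖ₑ ^ (2 : ℝ) ∂ν
        = ∫⁻ ω, (ν.map (A.act g)).rnDeriv ν ω * ‖h (A.act g⁻¹ ω)‖ₑ ^ (2 : ℝ) ∂ν := by
          refine lintegral_congr_ae ?_
          filter_upwards [Measure.rnDeriv_lt_top (ν.map (A.act g)) ν] with ω hω
          simp only [koopmanFun, enorm_mul]
          rw [ENNReal.mul_rpow_of_nonneg _ _ (by norm_num)]
          congr 1
          rw [Real.enorm_of_nonneg (Real.sqrt_nonneg _),
            ENNReal.ofReal_rpow_of_nonneg (Real.sqrt_nonneg _) (by norm_num)]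
          rw [Real.rpow_two, Real.sq_sqrt ENNReal.toReal_nonneg, ENNReal.ofReal_toReal hω.ne]
      _ = ∫⁻ ω, ‖h (A.act g⁻¹ ω)‖ₑ ^ (2 : ℝ) ∂(ν.map (A.act g)) :=
          lintegral_rnDeriv_mul (A.quasi g).absolutelyContinuous hm
      _ = ∫⁻ ω, ‖h (A.act g⁻¹ (A.act g ω))‖ₑ ^ (2 : ℝ) ∂ν :=
          lintegral_map' (hm.mono_ac (A.quasi g).absolutelyContinuous)
            (A.quasi g).measurable.aemeasurable
      _ = ∫⁻ ω, ‖h ω‖ₑ ^ (2 : ℝ) ∂ν := by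
          refine lintegral_congr_ae ?_
          filter_upwards [A.mul_ae g⁻¹ g, A.one_ae] with ω h1 h2
          rw [← h1, inv_mul_cancel, h2]
  rw [eLpNorm_eq_lintegral_rpow_enorm_toReal (by norm_num) (by norm_num),
    eLpNorm_eq_lintegral_rpow_enorm_toReal (by norm_num) (by norm_num)]
  simp only [ENNReal.toReal_ofNat]
  rw [key]

theorem memLp_koopmanFun (A : NonsingularAction G X ν) (g : G) {h : X → ℝ} (hh : MemLp h 2 ν) :
    MemLp (A.koopmanFun g h) 2 ν :=
  ⟨A.aestronglyMeasurable_koopmanFun g hh.1, by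
    rw [A.eLpNorm_koopmanFun g hh.1]
    exact hh.2⟩

/-- The Koopman representation `(π(g) h)(ω) = (d(g_* ν)/dν)^{1/2}(ω) h(g⁻¹ ω)` on `L²(X, ν)`.
This is the canonical representation on half-densities, trivialized by `h ↦ h ν^{1/2}`. -/
def koopman (A : NonsingularAction G X ν) (g : G) : Lp ℝ 2 ν →L[ℝ] Lp ℝ 2 ν :=
  LinearMap.mkContinuous
    { toFun := fun h => (A.memLp_koopmanFun g (Lp.memLp h)).toLp _
      map_add' := fun h k => by
        rw [← MemLp.toLp_add]
        refine MemLp.toLp_congr _ _ ((A.koopmanFun_congr g (Lp.coeFn_add h k)).trans ?_)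
        refine Eventually.of_forall fun ω => ?_
        simp [koopmanFun, mul_add]
      map_smul' := fun c h => by
        rw [RingHom.id_apply, ← MemLp.toLp_const_smul]
        refine MemLp.toLp_congr _ _ ((A.koopmanFun_congr g (Lp.coeFn_smul c h)).trans ?_)
        refine Eventually.of_forall fun ω => ?_
        simp only [koopmanFun, Pi.smul_apply, smul_eq_mul]
        ring }
    1 fun h => by
      simp only [LinearMap.coe_mk, AddHom.coe_mk, one_mul]
      rw [Lp.norm_toLp, A.eLpNorm_koopmanFun g (Lp.memLp h).1, Lp.norm_def]

end NonsingularAction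

/-! ### Gaussian densities and Gaussian actions -/

/-- A Gaussian density over the affine Hilbert space `P`: a family of equivalent probability
measures `m x`, `x ∈ P`, together with a linear map `f ↦ f̂` from the continuous affine functions
on `P` to random variables (modulo null sets), such that `f̂` has law `𝓝(f x, ‖f⁰‖²)` under `m x`
and the variables `f̂` generate the σ-algebra (modulo null sets). -/
structure IsGaussianDensity {V P X : Type*} [NormedAddCommGroup V] [InnerProductSpace ℝ V]
    [MetricSpace P] [NormedAddTorsor V P] [MeasurableSpace X] (m : P → Measure X) : Prop where
  prob : ∀ x, IsProbabilityMeasure (m x)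
  equiv : ∀ x y, m x ≪ m y
  exists_hat : ∃ hat : (P →ᴬ[ℝ] ℝ) → X → ℝ,
    (∀ f, Measurable (hat f)) ∧
    (∀ f k x, hat (f + k) =ᵐ[m x] hat f + hat k) ∧
    (∀ (c : ℝ) f x, hat (c • f) =ᵐ[m x] c • hat f) ∧
    (∀ f x, (m x).map (hat f) = gaussianReal (f x) (‖f.contLinear‖₊ ^ 2)) ∧
    (∀ S, MeasurableSet S → ∃ S', MeasurableSet[⨆ f, MeasurableSpace.comap (hat f) inferInstance] S'
      ∧ ∀ x, S =ᵐ[m x] S')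

/-- `A` is the nonsingular Gaussian action associated to `β`, on the Gaussian density `m`:
`(A g)_* m_x = m_{g x}` for all `g` and `x`. -/
def IsGaussianAction {G V P X : Type*} [Group G] [TopologicalSpace G] [NormedAddCommGroup V]
    [InnerProductSpace ℝ V] [MetricSpace P] [NormedAddTorsor V P] [MeasurableSpace X]
    (β : AffineIsometricAction G P) (m : P → Measure X) {ν : Measure X}
    (A : NonsingularAction G X ν) : Prop :=
  ∀ g x, (m x).map (A.act g) = m (β.hom g x)

/-- The `μ`-spectral radius of the Gaussian action of `β` is `r`. The Gaussian action is unique up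
to isomorphism but is realized on a Gaussian density that has to be chosen. So this says that some
realization exists, on a standard Borel space, and that in every realization, and for every
trivialization of the canonical `L²`-space by a measure `m y`, the Koopman representation has
`μ`-spectral radius `r`. -/
def HasGaussianSpectralRadius {G V P : Type*} [Group G]
    [TopologicalSpace G] [MeasurableSpace G]
    [NormedAddCommGroup V] [InnerProductSpace ℝ V] [MetricSpace P] [NormedAddTorsor V P]
    (β : AffineIsometricAction G P) (μ : Measure G) (r : ℝ) : Prop :=
  (∃ (X : Type) (_ : MeasurableSpace X) (_ : StandardBorelSpace X) (m : P → Measure X),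
    IsGaussianDensity m ∧ ∀ y, ∃ A : NonsingularAction G X (m y), IsGaussianAction β m A) ∧
  ∀ (X : Type w) [MeasurableSpace X] [StandardBorelSpace X] (m : P → Measure X)
    [∀ x, IsProbabilityMeasure (m x)], IsGaussianDensity m →
    ∀ (y : P) (A : NonsingularAction G X (m y)), IsGaussianAction β m A →
      HasSpectralRadius A.koopman μ r

end

/-!
On the canonical `L²`-space of a Gaussian density, the half-density of `m_x` is a unit vector
`ξ_x`, and `⟪ξ_x, ξ_y⟫ = exp (-d(x, y)² / 8)` by the Cameron–Martin formula. The Koopman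
representation maps `ξ_x` to `ξ_{gx}`, so the averaged operator `P = ∫ π(g) dμ(g)` satisfies
`⟪Pⁿ ξ_x, ξ_x⟫ = 𝔼 exp (-‖b(g_n)‖² / 8)`, which is at most `‖P‖ⁿ`.

Conversely, `P` is symmetric, so for every `r < ‖P‖` and every dense set of vectors some `η` in it
satisfies `⟪P²ⁿ η, η⟫ ≥ k r²ⁿ` with `k > 0`. For `η` in the span of the `ξ_a`, the triangle
inequality bounds `⟪π(g) η, η⟫` by a multiple of `exp (-c ‖b(g)‖² / 8)` for any `c < 1`, and
log-convexity in `s` of `𝔼 exp (-s ‖b(g_n)‖²)` allows `c → 1`. Hence the `n`-th roots converge to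
`‖P‖`, and rescaling the action gives all `s > 0`.

For the regular representation the same lower bound is applied to the functions with compact
support, whose matrix coefficients have compact support and so are dominated by `exp (-s ‖b(g)‖²)`.
The bound by `‖α‖_μ²` is Jensen's inequality for one step of the walk, with the basepoint varied.
-/

/-! ### Uniqueness of measures -/

theorem map_eq_of_mgf_eq {Ω Ω' : Type*} [MeasurableSpace Ω] [MeasurableSpace Ω'] {μ : Measure Ω}
    {μ' : Measure Ω'} [IsFiniteMeasure μ] [IsFiniteMeasure μ'] {X : Ω → ℝ} {Y : Ω' → ℝ}
    (hX : AEMeasurable X μ) (hY : AEMeasurable Y μ')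
    (hint : ∀ t : ℝ, Integrable (fun ω => Real.exp (t * X ω)) μ) (h : mgf X μ = mgf Y μ') :
    μ.map X = μ'.map Y := by
  have eq_zero_iff : μ = 0 ↔ μ' = 0 := by
    have mass_eq := congrFun h 0
    simp only [mgf_zero'] at mass_eq
    rw [← Measure.measure_univ_eq_zero, ← Measure.measure_univ_eq_zero (μ := μ'),
      ← measureReal_eq_zero_iff, ← measureReal_eq_zero_iff, mass_eq]
  have univ : integrableExpSet X μ = Set.univ := Set.eq_univ_of_forall hint
  refine Measure.ext_of_complexMGF_eq hX hY (funext fun z => ?_)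
  exact eqOn_complexMGF_of_mgf' h eq_zero_iff (by simp [univ])

theorem dual_pi_apply_eq_sum {I : Type*} [Fintype I] [DecidableEq I] (L : StrongDual ℝ (I → ℝ))
    (y : I → ℝ) : L y = ∑ i, L (Pi.single i 1) * y i := by
  conv_lhs => rw [← Finset.univ_sum_single y, map_sum]
  refine Finset.sum_congr rfl fun i _ => ?_
  rw [mul_comm, ← smul_eq_mul, ← map_smul, ← Pi.single_smul, smul_eq_mul, mul_one]

theorem map_pi_eq_of_map_sum_eq {I Ω : Type*} [MeasurableSpace Ω] {Y : I → Ω → ℝ}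
    (hY : ∀ i, Measurable (Y i)) {μ ν : Measure Ω} [IsFiniteMeasure μ] [IsFiniteMeasure ν]
    (h : ∀ (s : Finset I) (c : I → ℝ), μ.map (fun ω => ∑ i ∈ s, c i * Y i ω)
      = ν.map (fun ω => ∑ i ∈ s, c i * Y i ω)) :
    μ.map (fun ω i => Y i ω) = ν.map (fun ω i => Y i ω) := by
  classical
  have measurable_pi : Measurable (fun ω i => Y i ω) := measurable_pi_lambda _ hY
  refine IsProjectiveLimit.unique (P := fun s : Finset I => (ν.map (fun ω i => Y i ω)).map
    s.restrict) (fun s => ?_) (fun s => rfl)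
  beta_reduce
  have measurable_restrict : Measurable (s.restrict ∘ fun ω i => Y i ω) := by fun_prop
  rw [Measure.map_map (by fun_prop) measurable_pi, Measure.map_map (by fun_prop) measurable_pi]
  refine Measure.ext_of_charFunDual (funext fun L => ?_)
  have dual_comp : L ∘ s.restrict ∘ (fun ω i => Y i ω) = fun ω =>
      ∑ i ∈ s, (if hi : i ∈ s then L (Pi.single ⟨i, hi⟩ 1) else 0) * Y i ω := by
    funext ω
    rw [← Finset.sum_coe_sort s, Function.comp_apply, dual_pi_apply_eq_sum]
    simp [Finset.restrict]
  rw [charFunDual_eq_charFun_map_one, charFunDual_eq_charFun_map_one,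
    Measure.map_map (by fun_prop) measurable_restrict,
    Measure.map_map (by fun_prop) measurable_restrict, dual_comp, h]

section WithDensity

variable {X : Type*} [MeasurableSpace X] {p : Measure X} {F : X → ℝ}

theorem integrable_withDensity_ofReal_iff (hF : AEMeasurable F p) {g : X → ℝ} :
    Integrable g (p.withDensity fun x => ENNReal.ofReal (F x)) ↔
      Integrable (fun x => max (F x) 0 * g x) p := by
  simp [integrable_withDensity_iff_integrable_smul₀' hF.ennreal_ofReal, ENNReal.toReal_ofReal']

theorem integral_withDensity_ofReal (hF : AEMeasurable F p) (g : X → ℝ) :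
    ∫ x, g x ∂(p.withDensity fun x => ENNReal.ofReal (F x)) = ∫ x, max (F x) 0 * g x ∂p := by
  simp [integral_withDensity_eq_integral_toReal_smul₀ hF.ennreal_ofReal, ENNReal.toReal_ofReal']

theorem map_withDensity_ofReal_eq_map_withDensity_ofReal_neg {Y : X → ℝ} (hY : AEMeasurable Y p)
    (hF : Integrable F p) (hint : ∀ t : ℝ, Integrable (fun x => F x * Real.exp (t * Y x)) p)
    (h0 : ∀ t : ℝ, ∫ x, F x * Real.exp (t * Y x) ∂p = 0) :
    (p.withDensity fun x => ENNReal.ofReal (F x)).map Y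
      = (p.withDensity fun x => ENNReal.ofReal (-F x)).map Y := by
  have := isFiniteMeasure_withDensity_ofReal hF.2
  have : IsFiniteMeasure (p.withDensity fun x => ENNReal.ofReal (-F x)) :=
    isFiniteMeasure_withDensity_ofReal hF.neg.2
  have integrable_pos (t : ℝ) : Integrable (fun x => max (F x) 0 * Real.exp (t * Y x)) p := by
    refine (hint t).pos_part.congr (Eventually.of_forall fun x => ?_)
    simp [max_mul_of_nonneg _ _ (Real.exp_pos (t * Y x)).le]
  have integrable_neg (t : ℝ) : Integrable (fun x => max (-F x) 0 * Real.exp (t * Y x)) p := by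
    refine (hint t).neg_part.congr (Eventually.of_forall fun x => ?_)
    simp [max_mul_of_nonneg _ _ (Real.exp_pos (t * Y x)).le]
  refine map_eq_of_mgf_eq (hY.mono_ac (withDensity_absolutelyContinuous _ _))
    (hY.mono_ac (withDensity_absolutelyContinuous _ _))
    (fun t => (integrable_withDensity_ofReal_iff hF.aemeasurable).2 (integrable_pos t))
    (funext fun t => ?_)
  rw [mgf, mgf, integral_withDensity_ofReal hF.aemeasurable,
    integral_withDensity_ofReal (F := fun x => -F x) hF.neg.aemeasurable, ← sub_eq_zero,
    ← integral_sub (integrable_pos t) (integrable_neg t)]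
  simpa only [← sub_mul, max_zero_sub_max_neg_zero_eq_self] using h0 t

theorem ae_eq_zero_of_withDensity_ofReal_eq_neg (hF : Integrable F p)
    (h : p.withDensity (fun x => ENNReal.ofReal (F x))
      = p.withDensity fun x => ENNReal.ofReal (-F x)) : F =ᵐ[p] 0 := by
  have := isFiniteMeasure_withDensity_ofReal hF.2
  have lintegral_ne_top : ∫⁻ x, ENNReal.ofReal (F x) ∂p ≠ ∞ := by
    simpa using measure_ne_top (p.withDensity fun x => ENNReal.ofReal (F x)) Set.univ
  have parts_eq := (withDensity_eq_iff hF.aemeasurable.ennreal_ofReal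
    hF.neg.aemeasurable.ennreal_ofReal lintegral_ne_top).1 h
  filter_upwards [parts_eq] with x hx
  have max_eq := congrArg ENNReal.toReal hx
  simp only [ENNReal.toReal_ofReal', Pi.neg_apply] at max_eq
  rw [← max_zero_sub_max_neg_zero_eq_self (F x), max_eq, sub_self, Pi.zero_apply]

end WithDensity

/-! ### Isonormal Gaussian processes -/

/-- `W` is an isonormal Gaussian process over `V` on the probability space `(X, p)`: a linear family
of centred Gaussian variables with `Var (W v) = ‖v‖²`. As for Gaussian densities, linearity only
holds almost everywhere and `W` is required to generate the σ-algebra modulo null sets. -/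
structure IsIsonormal {V X : Type*} [NormedAddCommGroup V] [InnerProductSpace ℝ V]
    [MeasurableSpace X] (W : V → X → ℝ) (p : Measure X) : Prop where
  measurable : ∀ v, Measurable (W v)
  add_ae : ∀ u v, W (u + v) =ᵐ[p] W u + W v
  smul_ae : ∀ (c : ℝ) v, W (c • v) =ᵐ[p] c • W v
  law : ∀ v, p.map (W v) = gaussianReal 0 (‖v‖₊ ^ 2)
  generates : ∀ S, MeasurableSet S →
    ∃ S', MeasurableSet[⨆ v, MeasurableSpace.comap (W v) inferInstance] S' ∧ S =ᵐ[p] S'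

section CameronMartin

variable {V X : Type*} [NormedAddCommGroup V] (W : V → X → ℝ)

/-- The Cameron–Martin density `exp (W v - ‖v‖² / 2)`, of mean one when `W` is isonormal. -/
noncomputable def cameronMartin (v : V) (x : X) : ℝ := Real.exp (W v x - ‖v‖ ^ 2 / 2)

/-- The Cameron–Martin shift of `p` by `v`: it is the law under which, for an isonormal process
`W`, the variable `W u` has mean `⟪u, v⟫`. -/
noncomputable def shiftMeasure [MeasurableSpace X] (p : Measure X) (v : V) : Measure X :=
  p.withDensity fun x => ENNReal.ofReal (cameronMartin W v x)

/-- The square root of the Cameron–Martin density; these functions span the `L²`-space on which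
the Koopman representation acts. -/
noncomputable def halfDensity (v : V) (x : X) : ℝ := Real.exp (W v x / 2 - ‖v‖ ^ 2 / 4)

theorem halfDensity_eq_sqrt (v : V) (x : X) :
    halfDensity W v x = Real.sqrt (cameronMartin W v x) := by
  rw [halfDensity, cameronMartin, Real.sqrt_eq_rpow, ← Real.exp_mul]
  ring_nf

theorem shiftMeasure_absolutelyContinuous [MeasurableSpace X] (p : Measure X) (v : V) :
    shiftMeasure W p v ≪ p :=
  withDensity_absolutelyContinuous _ _

end CameronMartin

namespace IsIsonormal

variable {V X : Type*} [NormedAddCommGroup V] [InnerProductSpace ℝ V] [MeasurableSpace X]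
  {W : V → X → ℝ} {p : Measure X}

theorem isProbabilityMeasure (h : IsIsonormal W p) : IsProbabilityMeasure p := by
  have : IsProbabilityMeasure (p.map (W 0)) := by rw [h.law]; infer_instance
  exact Measure.isProbabilityMeasure_of_map (W 0)

theorem zero_ae (h : IsIsonormal W p) : W 0 =ᵐ[p] 0 := by
  simpa using h.smul_ae 0 0

theorem sum_ae (h : IsIsonormal W p) {I : Type*} (s : Finset I) (c : I → ℝ) (v : I → V) :
    (fun x => ∑ i ∈ s, c i * W (v i) x) =ᵐ[p] W (∑ i ∈ s, c i • v i) := by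
  classical
  induction s using Finset.induction_on with
  | empty =>
    simp only [Finset.sum_empty]
    exact h.zero_ae.symm
  | insert i s hi ih =>
    rw [Finset.sum_insert hi]
    filter_upwards [ih, h.add_ae (c i • v i) (∑ i ∈ s, c i • v i), h.smul_ae (c i) (v i)]
      with x sum_x add_x smul_x
    rw [Finset.sum_insert hi, sum_x, add_x, Pi.add_apply, smul_x, Pi.smul_apply, smul_eq_mul]

theorem measure_ext (h : IsIsonormal W p) {q₁ q₂ : Measure X} [IsFiniteMeasure q₁]
    [IsFiniteMeasure q₂] (hq₁ : q₁ ≪ p) (hq₂ : q₂ ≪ p)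
    (hmap : ∀ v, q₁.map (W v) = q₂.map (W v)) : q₁ = q₂ := by
  have measurable_pi : Measurable (fun x v => W v x) := measurable_pi_lambda _ h.measurable
  have joint_law : q₁.map (fun x v => W v x) = q₂.map (fun x v => W v x) :=
    map_pi_eq_of_map_sum_eq h.measurable fun s c => by
      have sum_eq : (fun x => ∑ v ∈ s, c v * W v x) =ᵐ[p] _ := h.sum_ae s c id
      rw [Measure.map_congr (hq₁.ae_le sum_eq), hmap, Measure.map_congr (hq₂.ae_le sum_eq)]
  have generated : (⨆ v, MeasurableSpace.comap (W v) inferInstance)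
      = MeasurableSpace.comap (fun x v => W v x) inferInstance := by
    simp [MeasurableSpace.pi, MeasurableSpace.comap_iSup, MeasurableSpace.comap_comp,
      Function.comp_def]
  ext S hS
  obtain ⟨S', hS', hSS'⟩ := h.generates S hS
  rw [generated] at hS'
  obtain ⟨T, hT, rfl⟩ := hS'
  rw [measure_congr (hq₁.ae_le hSS'), measure_congr (hq₂.ae_le hSS'),
    ← Measure.map_apply measurable_pi hT, joint_law, Measure.map_apply measurable_pi hT]

theorem integrable_exp (h : IsIsonormal W p) (v : V) (c : ℝ) :
    Integrable (fun x => Real.exp (W v x + c)) p := by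
  have integrable_gaussian := integrable_exp_mul_gaussianReal (μ := 0) (v := ‖v‖₊ ^ 2) 1
  rw [← h.law v, integrable_map_measure (by fun_prop) (h.measurable v).aemeasurable]
    at integrable_gaussian
  simpa [Real.exp_add, Function.comp_def] using integrable_gaussian.mul_const (Real.exp c)

theorem integral_exp (h : IsIsonormal W p) (v : V) (c : ℝ) :
    ∫ x, Real.exp (W v x + c) ∂p = Real.exp (‖v‖ ^ 2 / 2 + c) := by
  have mgf_one := mgf_gaussianReal (h.law v) 1
  simp only [mgf, one_mul] at mgf_one
  simp [Real.exp_add, integral_mul_const, mgf_one]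

theorem memLp_exp (h : IsIsonormal W p) (v : V) (c : ℝ) :
    MemLp (fun x => Real.exp (W v x + c)) 2 p := by
  have := h.measurable v
  rw [memLp_two_iff_integrable_sq (by fun_prop)]
  refine (h.integrable_exp ((2 : ℝ) • v) (2 * c)).congr ?_
  filter_upwards [h.smul_ae 2 v] with x smul_x
  rw [smul_x, ← Real.exp_nat_mul, Pi.smul_apply, smul_eq_mul]
  push_cast
  ring_nf

theorem measurable_cameronMartin (h : IsIsonormal W p) (v : V) :
    Measurable (cameronMartin W v) :=
  ((h.measurable v).sub_const _).exp

theorem absolutelyContinuous_shiftMeasure (h : IsIsonormal W p) (v : V) :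
    p ≪ shiftMeasure W p v :=
  withDensity_absolutelyContinuous' (h.measurable_cameronMartin v).ennreal_ofReal.aemeasurable
    (Eventually.of_forall fun _ => by simp [cameronMartin, Real.exp_pos])

theorem isProbabilityMeasure_shiftMeasure (h : IsIsonormal W p) (v : V) :
    IsProbabilityMeasure (shiftMeasure W p v) := by
  constructor
  rw [shiftMeasure, withDensity_apply _ MeasurableSet.univ, Measure.restrict_univ]
  simp only [cameronMartin, sub_eq_add_neg]
  rw [← ofReal_integral_eq_lintegral_ofReal (h.integrable_exp v _)
    (Eventually.of_forall fun _ => (Real.exp_pos _).le), h.integral_exp]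
  simp

theorem cameronMartin_mul_exp_ae (h : IsIsonormal W p) (u v : V) (t : ℝ) :
    (fun x => cameronMartin W v x * Real.exp (t * W u x)) =ᵐ[p]
      fun x => Real.exp (W (v + t • u) x + -(‖v‖ ^ 2 / 2)) := by
  filter_upwards [h.add_ae v (t • u), h.smul_ae t u] with x add_x smul_x
  rw [add_x, cameronMartin, ← Real.exp_add, Pi.add_apply, smul_x, Pi.smul_apply, smul_eq_mul]
  ring_nf

theorem map_shiftMeasure (h : IsIsonormal W p) (u v : V) :
    (shiftMeasure W p v).map (W u) = gaussianReal ⟪u, v⟫ (‖u‖₊ ^ 2) := by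
  have := h.isProbabilityMeasure_shiftMeasure v
  have aemeasurable := (h.measurable_cameronMartin v).aemeasurable (μ := p)
  have max_eq (x : X) : max (cameronMartin W v x) 0 = cameronMartin W v x :=
    max_eq_left (Real.exp_pos _).le
  conv_rhs => rw [← Measure.map_id (μ := gaussianReal ⟪u, v⟫ (‖u‖₊ ^ 2))]
  refine map_eq_of_mgf_eq (h.measurable u).aemeasurable aemeasurable_id (fun t => ?_)
    (funext fun t => ?_)
  · rw [shiftMeasure, integrable_withDensity_ofReal_iff aemeasurable]
    simp only [max_eq]
    exact (h.integrable_exp _ _).congr (h.cameronMartin_mul_exp_ae u v t).symm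
  · rw [mgf_id_gaussianReal, mgf, shiftMeasure, integral_withDensity_ofReal aemeasurable]
    simp only [max_eq]
    rw [integral_congr_ae (h.cameronMartin_mul_exp_ae u v t), h.integral_exp, norm_add_sq_real,
      inner_smul_right, norm_smul, real_inner_comm]
    push_cast
    rw [mul_pow, Real.norm_eq_abs, sq_abs]
    ring_nf

theorem eq_shiftMeasure (h : IsIsonormal W p) {q : Measure X} [IsFiniteMeasure q] (hq : q ≪ p)
    (v : V) (hmap : ∀ u, q.map (W u) = gaussianReal ⟪u, v⟫ (‖u‖₊ ^ 2)) :
    q = shiftMeasure W p v := by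
  have := h.isProbabilityMeasure_shiftMeasure v
  exact h.measure_ext hq (shiftMeasure_absolutelyContinuous W p v) fun u => by
    rw [hmap, h.map_shiftMeasure]

theorem halfDensity_ae (h : IsIsonormal W p) (v : V) :
    halfDensity W v =ᵐ[p] fun x => Real.exp (W ((2⁻¹ : ℝ) • v) x + -(‖v‖ ^ 2 / 4)) := by
  filter_upwards [h.smul_ae 2⁻¹ v] with x smul_x
  rw [smul_x, halfDensity, Pi.smul_apply, smul_eq_mul]
  ring_nf

theorem halfDensity_mul_ae (h : IsIsonormal W p) (u v : V) :
    (fun x => halfDensity W u x * halfDensity W v x) =ᵐ[p]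
      fun x => Real.exp (W ((2⁻¹ : ℝ) • (u + v)) x + (-(‖u‖ ^ 2 / 4) - ‖v‖ ^ 2 / 4)) := by
  filter_upwards [h.smul_ae (2⁻¹ : ℝ) (u + v), h.add_ae u v] with x smul_x add_x
  rw [smul_x, halfDensity, halfDensity, ← Real.exp_add, Pi.smul_apply, add_x, Pi.add_apply,
    smul_eq_mul]
  ring_nf

theorem memLp_halfDensity (h : IsIsonormal W p) (v : V) : MemLp (halfDensity W v) 2 p :=
  (memLp_congr_ae (h.halfDensity_ae v)).2 (h.memLp_exp _ _)

/-- The half density `halfDensity W v` as a vector of `L²(X, p)`. -/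
noncomputable def halfDensityLp (h : IsIsonormal W p) (v : V) : Lp ℝ 2 p :=
  (h.memLp_halfDensity v).toLp _

theorem coeFn_halfDensityLp (h : IsIsonormal W p) (v : V) :
    h.halfDensityLp v =ᵐ[p] halfDensity W v :=
  (h.memLp_halfDensity v).coeFn_toLp

theorem inner_halfDensityLp_eq_integral (h : IsIsonormal W p) (v : V) (F : Lp ℝ 2 p) :
    ⟪h.halfDensityLp v, F⟫ = ∫ x, F x * halfDensity W v x ∂p := by
  rw [L2.inner_def]
  refine integral_congr_ae ?_
  filter_upwards [h.coeFn_halfDensityLp v] with x coeFn_x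
  rw [coeFn_x, real_inner_eq_re_inner]
  rfl

theorem inner_halfDensityLp (h : IsIsonormal W p) (u v : V) :
    ⟪h.halfDensityLp u, h.halfDensityLp v⟫ = Real.exp (-(‖u - v‖ ^ 2) / 8) := by
  have integrand_ae : (fun x => h.halfDensityLp v x * halfDensity W u x) =ᵐ[p]
      fun x => halfDensity W v x * halfDensity W u x := by
    filter_upwards [h.coeFn_halfDensityLp v] with x coeFn_x
    rw [coeFn_x]
  rw [inner_halfDensityLp_eq_integral, integral_congr_ae (integrand_ae.trans
    (h.halfDensity_mul_ae v u)), h.integral_exp, norm_smul, mul_pow, norm_add_sq_real,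
    norm_sub_sq_real, real_inner_comm]
  norm_num
  ring

theorem ae_eq_zero_of_integral_mul_exp_eq_zero (h : IsIsonormal W p) {F : X → ℝ}
    (hF : MemLp F 2 p) (h0 : ∀ v, ∫ x, F x * Real.exp (W v x) ∂p = 0) : F =ᵐ[p] 0 := by
  have := h.isProbabilityMeasure
  have integrable_F : Integrable F p := hF.integrable one_le_two
  have := isFiniteMeasure_withDensity_ofReal integrable_F.2
  have : IsFiniteMeasure (p.withDensity fun x => ENNReal.ofReal (-F x)) :=
    isFiniteMeasure_withDensity_ofReal integrable_F.neg.2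
  have exp_smul_ae (v : V) (t : ℝ) : (fun x => F x * Real.exp (W (t • v) x)) =ᵐ[p]
      fun x => F x * Real.exp (t * W v x) := by
    filter_upwards [h.smul_ae t v] with x smul_x
    rw [smul_x, Pi.smul_apply, smul_eq_mul]
  have memLp_exp (v : V) : MemLp (fun x => Real.exp (W v x)) 2 p := by
    simpa using h.memLp_exp v 0
  exact ae_eq_zero_of_withDensity_ofReal_eq_neg integrable_F <|
    h.measure_ext (withDensity_absolutelyContinuous _ _) (withDensity_absolutelyContinuous _ _)
      fun v => map_withDensity_ofReal_eq_map_withDensity_ofReal_neg (h.measurable v).aemeasurable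
        integrable_F (fun t => (hF.integrable_mul (memLp_exp _)).congr (exp_smul_ae v t))
        fun t => by rw [← integral_congr_ae (exp_smul_ae v t), h0]

theorem eq_zero_of_inner_halfDensityLp_eq_zero (h : IsIsonormal W p) {F : Lp ℝ 2 p}
    (hF : ∀ v, ⟪h.halfDensityLp v, F⟫ = 0) : F = 0 := by
  refine Lp.eq_zero_iff_ae_eq_zero.2 <|
    h.ae_eq_zero_of_integral_mul_exp_eq_zero (Lp.memLp F) fun v => ?_
  have integrand_ae : (fun x => F x * halfDensity W ((2 : ℝ) • v) x) =ᵐ[p]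
      fun x => F x * Real.exp (W v x) * Real.exp (-(‖(2 : ℝ) • v‖ ^ 2 / 4)) := by
    filter_upwards [h.halfDensity_ae ((2 : ℝ) • v)] with x half_x
    rw [half_x, inv_smul_smul₀ two_ne_zero, Real.exp_add, mul_assoc]
  have inner_eq := hF ((2 : ℝ) • v)
  rw [inner_halfDensityLp_eq_integral, integral_congr_ae integrand_ae,
    integral_mul_const] at inner_eq
  exact (mul_eq_zero.1 inner_eq).resolve_right (Real.exp_pos _).ne'

theorem topologicalClosure_span_halfDensityLp (h : IsIsonormal W p) :
    (Submodule.span ℝ (Set.range h.halfDensityLp)).topologicalClosure = ⊤ := by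
  rw [Submodule.topologicalClosure_eq_top_iff, Submodule.eq_bot_iff]
  intro F hF
  exact h.eq_zero_of_inner_halfDensityLp_eq_zero fun v =>
    (Submodule.mem_orthogonal _ _).1 hF _ (Submodule.subset_span ⟨v, rfl⟩)

end IsIsonormal

/-! ### Random walks -/

section Walk

variable {G : Type*} [Group G]

theorem walk_succ (n : ℕ) (ω : ℕ → G) : walk (n + 1) ω = walk n ω * ω n := by
  simp [walk, List.range_succ]

theorem walk_congr {n : ℕ} {ω ω' : ℕ → G} (h : ∀ i < n, ω i = ω' i) : walk n ω = walk n ω' :=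
  congrArg List.prod (List.map_congr_left fun i hi => h i (List.mem_range.1 hi))

variable [MeasurableSpace G]

/-- The law of the position after `n` steps of the `μ`-random walk, i.e. the `n`-th convolution
power of `μ`. -/
noncomputable def walkLaw (μ : Measure G) (n : ℕ) : Measure G :=
  (Measure.infinitePi fun _ : ℕ => μ).map (walk n)

theorem walkLaw_zero (μ : Measure G) [IsProbabilityMeasure μ] :
    walkLaw μ 0 = Measure.dirac 1 := by
  rw [walkLaw, show walk (G := G) 0 = fun _ => 1 from rfl, Measure.map_const, measure_univ,
    one_smul]

variable [MeasurableMul₂ G]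

theorem measurable_walk (n : ℕ) : Measurable (walk (G := G) n) := by
  induction n with
  | zero => exact measurable_const
  | succ n ih =>
    rw [funext (walk_succ n)]
    exact ih.mul (measurable_pi_apply n)

variable (μ : Measure G)

instance isProbabilityMeasure_walkLaw [IsProbabilityMeasure μ] (n : ℕ) :
    IsProbabilityMeasure (walkLaw μ n) :=
  Measure.isProbabilityMeasure_map (measurable_walk n).aemeasurable

theorem walkExpectation_eq_integral_walkLaw (n : ℕ) {F : G → ℝ}
    (hF : AEStronglyMeasurable F (walkLaw μ n)) :
    walkExpectation μ n F = ∫ g, F g ∂(walkLaw μ n) :=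
  (integral_map (measurable_walk n).aemeasurable hF).symm

variable [IsProbabilityMeasure μ]

theorem indepFun_walk_eval (n : ℕ) :
    IndepFun (walk n) (fun ω : ℕ → G => ω n) (Measure.infinitePi fun _ : ℕ => μ) := by
  have indep_coord : iIndepFun (fun (i : ℕ) (ω : ℕ → G) => ω i)
      (Measure.infinitePi fun _ : ℕ => μ) :=
    iIndepFun_infinitePi (X := fun _ x => x) (fun _ => measurable_id)
  have indep_blocks := indep_coord.indepFun_finset (Finset.range n) {n} (by simp)
    measurable_pi_apply
  let extend (x : Finset.range n → G) (i : ℕ) : G :=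
    if hi : i ∈ Finset.range n then x ⟨i, hi⟩ else 1
  have measurable_extend : Measurable extend := by
    refine measurable_pi_lambda _ fun i => ?_
    by_cases hi : i ∈ Finset.range n
    · simpa only [extend, hi, dite_true] using measurable_pi_apply _
    · simp only [extend, hi, dite_false, measurable_const]
  have walk_extend (ω : ℕ → G) : walk n (extend ((Finset.range n).restrict ω)) = walk n ω :=
    walk_congr fun i hi => by simp [extend, hi]
  exact (indep_blocks.comp ((measurable_walk n).comp measurable_extend)
    (measurable_pi_apply ⟨n, Finset.mem_singleton_self n⟩)).congr
    (Eventually.of_forall walk_extend) (Eventually.of_forall fun _ => rfl)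

theorem walkLaw_succ (n : ℕ) : walkLaw μ (n + 1) = walkLaw μ n ∗ₘ μ := by
  have map_prodMk := (indepFun_iff_map_prod_eq_prod_map_map (measurable_walk n).aemeasurable
    (measurable_pi_apply n).aemeasurable).1 (indepFun_walk_eval μ n)
  rw [Measure.infinitePi_map_eval (fun _ : ℕ => μ) n] at map_prodMk
  rw [Measure.mconv, walkLaw, walkLaw, ← map_prodMk, Measure.map_map (by fun_prop)
    ((measurable_walk n).prodMk (measurable_pi_apply n))]
  exact congrArg (Measure.map · _) (funext fun ω => walk_succ n ω)

theorem walkLaw_one : walkLaw μ 1 = μ := by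
  rw [walkLaw_succ, walkLaw_zero, Measure.dirac_one_mconv]

theorem integral_walkLaw_succ (n : ℕ) {E : Type*} [NormedAddCommGroup E] [NormedSpace ℝ E]
    {F : G → E} (hF : Integrable F (walkLaw μ (n + 1))) :
    ∫ g, F g ∂(walkLaw μ (n + 1)) = ∫ g, ∫ h, F (g * h) ∂μ ∂(walkLaw μ n) := by
  rw [walkLaw_succ] at hF ⊢
  exact integral_mconv hF

end Walk

section SymmetricOperator

variable {𝕜 H : Type*} [RCLike 𝕜] [NormedAddCommGroup H] [InnerProductSpace 𝕜 H]
  {T : H →ₗ[𝕜] H}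

theorem inner_pow_two_mul_of_isSymmetric (hT : T.IsSymmetric) (n : ℕ) (η : H) :
    inner 𝕜 ((T ^ (2 * n)) η) η = (‖(T ^ n) η‖ : 𝕜) ^ 2 := by
  rw [two_mul, pow_add, Module.End.mul_apply, hT.pow n, inner_self_eq_norm_sq_to_K]

theorem norm_pow_succ_sq_le_of_isSymmetric (hT : T.IsSymmetric) (n : ℕ) (η : H) :
    ‖(T ^ (n + 1)) η‖ ^ 2 ≤ ‖(T ^ n) η‖ * ‖(T ^ (n + 2)) η‖ := by
  calc ‖(T ^ (n + 1)) η‖ ^ 2 = ‖inner 𝕜 ((T ^ (n + 1)) η) ((T ^ (n + 1)) η)‖ := by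
        rw [inner_self_eq_norm_sq_to_K, norm_pow, RCLike.norm_ofReal, abs_norm]
    _ = ‖inner 𝕜 ((T ^ n) η) ((T ^ (n + 2)) η)‖ := by
        rw [pow_succ' T (n + 1), pow_succ' T n, Module.End.mul_apply, Module.End.mul_apply,
          Module.End.mul_apply, hT]
    _ ≤ ‖(T ^ n) η‖ * ‖(T ^ (n + 2)) η‖ := norm_inner_le_norm _ _

theorem norm_mul_norm_pow_le_of_isSymmetric (hT : T.IsSymmetric) (n : ℕ) (η : H) :
    ‖T η‖ * ‖(T ^ n) η‖ ≤ ‖η‖ * ‖(T ^ (n + 1)) η‖ := by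
  induction n with
  | zero => simp [mul_comm]
  | succ n ih =>
    have log_convex := norm_pow_succ_sq_le_of_isSymmetric hT n η
    rcases (norm_nonneg ((T ^ n) η)).eq_or_lt with h0 | h0
    · have pow_succ_eq_zero : ‖(T ^ (n + 1)) η‖ = 0 := by
        rw [← h0, zero_mul] at log_convex
        exact pow_eq_zero_iff two_ne_zero |>.1 (le_antisymm log_convex (sq_nonneg _))
      rw [pow_succ_eq_zero, mul_zero]
      positivity
    · refine le_of_mul_le_mul_left ?_ h0
      calc ‖(T ^ n) η‖ * (‖T η‖ * ‖(T ^ (n + 1)) η‖)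
          = (‖T η‖ * ‖(T ^ n) η‖) * ‖(T ^ (n + 1)) η‖ := by ring
        _ ≤ (‖η‖ * ‖(T ^ (n + 1)) η‖) * ‖(T ^ (n + 1)) η‖ := by gcongr
        _ = ‖η‖ * ‖(T ^ (n + 1)) η‖ ^ 2 := by ring
        _ ≤ ‖η‖ * (‖(T ^ n) η‖ * ‖(T ^ (n + 2)) η‖) := by gcongr
        _ = ‖(T ^ n) η‖ * (‖η‖ * ‖(T ^ (n + 1 + 1)) η‖) := by ring

theorem pow_mul_norm_le_of_isSymmetric (hT : T.IsSymmetric) {r : ℝ} (hr : 0 ≤ r) {η : H}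
    (h : r * ‖η‖ ≤ ‖T η‖) (n : ℕ) : r ^ n * ‖η‖ ≤ ‖(T ^ n) η‖ := by
  rcases (norm_nonneg η).eq_or_lt with h0 | h0
  · rw [← h0, mul_zero]
    exact norm_nonneg _
  induction n with
  | zero => simp
  | succ n ih =>
    refine le_of_mul_le_mul_left ?_ h0
    calc ‖η‖ * (r ^ (n + 1) * ‖η‖) = (r * ‖η‖) * (r ^ n * ‖η‖) := by ring
      _ ≤ ‖T η‖ * ‖(T ^ n) η‖ := by gcongr
      _ ≤ ‖η‖ * ‖(T ^ (n + 1)) η‖ := norm_mul_norm_pow_le_of_isSymmetric hT n η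

end SymmetricOperator

/-! ### Orthogonal representations and averaged operators -/

/-- `U` is a weakly continuous orthogonal representation of `G`; orthogonality is expressed by
`(U g)* = U g⁻¹`. -/
structure IsOrthogonalRep {G H : Type*} [Group G] [TopologicalSpace G] [NormedAddCommGroup H]
    [InnerProductSpace ℝ H] (U : G → H →L[ℝ] H) : Prop where
  one : ∀ ξ, U 1 ξ = ξ
  mul : ∀ g h ξ, U (g * h) ξ = U g (U h ξ)
  adjoint : ∀ g ξ η, ⟪U g ξ, η⟫ = ⟪ξ, U g⁻¹ η⟫
  continuous : ∀ ξ η, Continuous fun g => ⟪U g ξ, η⟫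

/-- `T` is the weak integral of `U` against `μ`. -/
def IsWeakIntegral {G H : Type*} [MeasurableSpace G] [NormedAddCommGroup H]
    [InnerProductSpace ℝ H] (U : G → H →L[ℝ] H) (μ : Measure G) (T : H →L[ℝ] H) : Prop :=
  ∀ ξ η : H, Integrable (fun g => ⟪U g ξ, η⟫) μ ∧ ⟪T ξ, η⟫ = ∫ g, ⟪U g ξ, η⟫ ∂μ

theorem exists_clm_inner_eq {H : Type*} [NormedAddCommGroup H] [InnerProductSpace ℝ H]
    [CompleteSpace H] (B : H →ₗ[ℝ] H →ₗ[ℝ] ℝ) {C : ℝ} (hC : ∀ ξ η, ‖B ξ η‖ ≤ C * ‖ξ‖ * ‖η‖) :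
    ∃ T : H →L[ℝ] H, ∀ ξ η, ⟪T ξ, η⟫ = B ξ η :=
  ⟨_, InnerProductSpace.continuousLinearMapOfBilin_apply (𝕜 := ℝ) (B.mkContinuous₂ C hC)⟩

theorem exists_mul_norm_lt_norm_of_dense {H E : Type*} [NormedAddCommGroup H] [NormedSpace ℝ H]
    [NormedAddCommGroup E] [NormedSpace ℝ E] {T : H →L[ℝ] E} {D : Set H} (hD : Dense D) {r : ℝ}
    (hr : 0 ≤ r) (hrT : r < ‖T‖) : ∃ η ∈ D, r * ‖η‖ < ‖T η‖ := by
  by_contra! hle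
  have closed : IsClosed {ξ | ‖T ξ‖ ≤ r * ‖ξ‖} := isClosed_le (by fun_prop) (by fun_prop)
  exact hrT.not_ge (T.opNorm_le_bound hr fun ξ => closed.closure_subset_iff.2 hle (hD ξ))

theorem norm_map_of_inner_map_eq {H : Type*} [NormedAddCommGroup H] [InnerProductSpace ℝ H]
    {A B : H → H} (adjoint : ∀ ξ η, ⟪A ξ, η⟫ = ⟪ξ, B η⟫) (left_inv : ∀ ξ, B (A ξ) = ξ) (ξ : H) :
    ‖A ξ‖ = ‖ξ‖ := by
  rw [← sq_eq_sq₀ (norm_nonneg _) (norm_nonneg _), ← real_inner_self_eq_norm_sq, adjoint, left_inv,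
    real_inner_self_eq_norm_sq]

theorem continuous_clm_apply_of_dense_span {X E F : Type*} [TopologicalSpace X]
    [SeminormedAddCommGroup E] [NormedSpace ℝ E] [SeminormedAddCommGroup F] [NormedSpace ℝ F]
    {S : Set E} (hS : Dense (Submodule.span ℝ S : Set E)) {K : X → E →L[ℝ] F} {C : ℝ}
    (hC : ∀ x, ‖K x‖ ≤ C) (h : ∀ ξ ∈ S, Continuous fun x => K x ξ) (ξ : E) :
    Continuous fun x => K x ξ := by
  have equicontinuous : Equicontinuous fun x => ⇑(K x) :=
    (LipschitzWith.uniformEquicontinuous _ C.toNNReal fun x =>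
      (K x).lipschitz.weaken (by simpa using Real.toNNReal_mono (hC x))).equicontinuous
  have on_span : ∀ η ∈ Submodule.span ℝ S, Continuous fun x => K x η := fun η hη => by
    induction hη using Submodule.span_induction with
    | mem η hη => exact h η hη
    | zero => simpa only [map_zero] using continuous_const
    | add η η' _ _ hη hη' =>
      simp only [map_add]
      exact hη.add hη'
    | smul c η _ hη =>
      simp only [map_smul]
      exact hη.const_smul c
  refine continuous_iff_continuousAt.2 fun x₀ => ?_
  have closed : IsClosed {η | Tendsto (fun x => K x η) (𝓝 x₀) (𝓝 (K x₀ η))} :=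
    equicontinuous.isClosed_setOfPred_tendsto (K x₀).continuous
  exact closed.closure_subset_iff.2 (fun η hη => (on_span η hη).tendsto x₀) (hS ξ)

theorem isBigO_inner_of_mem_span {X H : Type*} [NormedAddCommGroup H] [InnerProductSpace ℝ H]
    {U : X → H →L[ℝ] H} {S : Set H} {l : Filter X} {φ : X → ℝ}
    (h : ∀ ξ ∈ S, ∀ η ∈ S, (fun x => ⟪U x ξ, η⟫) =O[l] φ) {ξ η : H}
    (hξ : ξ ∈ Submodule.span ℝ S) (hη : η ∈ Submodule.span ℝ S) :
    (fun x => ⟪U x ξ, η⟫) =O[l] φ := by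
  induction hξ, hη using Submodule.span_induction₂ with
  | mem_mem ξ η hξ hη => exact h ξ hξ η hη
  | zero_left η _ =>
    simpa only [map_zero, inner_zero_left] using Asymptotics.isBigO_zero φ l
  | zero_right ξ _ => simpa only [inner_zero_right] using Asymptotics.isBigO_zero φ l
  | add_left ξ ξ' η _ _ _ hξ hξ' => simpa only [map_add, inner_add_left] using hξ.add hξ'
  | add_right ξ η η' _ _ _ hη hη' => simpa only [inner_add_right] using hη.add hη'
  | smul_left c ξ η _ _ hξ =>
    simpa only [map_smul, real_inner_smul_left] using hξ.const_mul_left c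
  | smul_right c ξ η _ _ hη => simpa only [real_inner_smul_right] using hη.const_mul_left c

namespace IsOrthogonalRep

variable {G H : Type*} [Group G] [TopologicalSpace G] [NormedAddCommGroup H]
    [InnerProductSpace ℝ H] {U : G → H →L[ℝ] H}

theorem of_dense_span {S : Set H} (hS : Dense (Submodule.span ℝ S : Set H))
    (one : ∀ ξ ∈ S, U 1 ξ = ξ) (mul : ∀ g h, ∀ ξ ∈ S, U (g * h) ξ = U g (U h ξ))
    (adjoint : ∀ g, ∀ ξ ∈ S, ∀ η ∈ S, ⟪U g ξ, η⟫ = ⟪ξ, U g⁻¹ η⟫)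
    (continuous : ∀ ξ ∈ S, ∀ η ∈ S, Continuous fun g => ⟪U g ξ, η⟫) : IsOrthogonalRep U := by
  have one' (ξ : H) : U 1 ξ = ξ :=
    DFunLike.congr_fun (ContinuousLinearMap.ext_on (g := .id ℝ H) hS one) ξ
  have mul' (g h : G) (ξ : H) : U (g * h) ξ = U g (U h ξ) :=
    DFunLike.congr_fun (ContinuousLinearMap.ext_on (g := (U g).comp (U h)) hS (mul g h)) ξ
  have adjoint_left (g : G) (ξ η : H) (hη : η ∈ S) : ⟪U g ξ, η⟫ = ⟪ξ, U g⁻¹ η⟫ := by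
    rw [real_inner_comm, real_inner_comm (U g⁻¹ η)]
    refine DFunLike.congr_fun (ContinuousLinearMap.ext_on (f := (innerSL ℝ η).comp (U g))
      (g := innerSL ℝ (U g⁻¹ η)) hS fun ξ hξ => ?_) ξ
    simpa [real_inner_comm] using adjoint g ξ hξ η hη
  have adjoint' (g : G) (ξ η : H) : ⟪U g ξ, η⟫ = ⟪ξ, U g⁻¹ η⟫ :=
    DFunLike.congr_fun (ContinuousLinearMap.ext_on (f := innerSL ℝ (U g ξ))
      (g := (innerSL ℝ ξ).comp (U g⁻¹)) hS (adjoint_left g ξ)) η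
  have norm_map (g : G) (ξ : H) : ‖U g ξ‖ = ‖ξ‖ :=
    norm_map_of_inner_map_eq (adjoint' g) (fun ξ => by rw [← mul', inv_mul_cancel, one']) ξ
  have continuous_left (ξ η : H) (hη : η ∈ S) : Continuous fun g => ⟪U g ξ, η⟫ := by
    simp only [real_inner_comm η]
    refine continuous_clm_apply_of_dense_span (K := fun g => (innerSL ℝ η).comp (U g)) hS
      (C := ‖η‖) (fun g => ?_) (fun ξ hξ => ?_) ξ
    · refine ContinuousLinearMap.opNorm_le_bound _ (norm_nonneg _) fun ξ => ?_
      rw [← norm_map g ξ]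
      exact norm_inner_le_norm _ _
    · simpa [real_inner_comm] using continuous ξ hξ η hη
  exact ⟨one', mul', adjoint', fun ξ η => continuous_clm_apply_of_dense_span
    (K := fun g => innerSL ℝ (U g ξ)) hS (C := ‖ξ‖)
    (fun g => by rw [innerSL_apply_norm, norm_map]) (continuous_left ξ) η⟩

theorem norm_map (hU : IsOrthogonalRep U) (g : G) (ξ : H) : ‖U g ξ‖ = ‖ξ‖ :=
  norm_map_of_inner_map_eq (hU.adjoint g)
    (fun ξ => by rw [← hU.mul, inv_mul_cancel, hU.one]) ξ

theorem abs_inner_le (hU : IsOrthogonalRep U) (g : G) (ξ η : H) : |⟪U g ξ, η⟫| ≤ ‖ξ‖ * ‖η‖ := by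
  rw [← hU.norm_map g ξ]
  exact abs_real_inner_le_norm _ _

theorem tendsto_norm_sub (hU : IsOrthogonalRep U) (ξ : H) :
    Tendsto (fun g => ‖U g ξ - ξ‖) (𝓝 1) (𝓝 0) := by
  have norm_sub_eq (g : G) : ‖U g ξ - ξ‖ = Real.sqrt (2 * ‖ξ‖ ^ 2 - 2 * ⟪U g ξ, ξ⟫) := by
    rw [← Real.sqrt_sq (norm_nonneg (U g ξ - ξ)), norm_sub_sq_real, hU.norm_map]
    ring_nf
  have sqrt_continuous : Continuous fun g => Real.sqrt (2 * ‖ξ‖ ^ 2 - 2 * ⟪U g ξ, ξ⟫) := by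
    have := hU.continuous ξ ξ
    fun_prop
  simp_rw [norm_sub_eq]
  simpa only [hU.one, real_inner_self_eq_norm_sq, sub_self, Real.sqrt_zero]
    using sqrt_continuous.tendsto 1

variable [MeasurableSpace G] {μ : Measure G} {T : H →L[ℝ] H}

theorem norm_le_one_of_isWeakIntegral [IsProbabilityMeasure μ] (hU : IsOrthogonalRep U)
    (hT : IsWeakIntegral U μ T) : ‖T‖ ≤ 1 := by
  refine T.opNorm_le_of_re_inner_le zero_le_one fun ξ η hξ hη => ?_
  have bound (g : G) : ⟪U g ξ, η⟫ ≤ 1 := by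
    simpa [hξ, hη] using (le_abs_self _).trans (hU.abs_inner_le g ξ η)
  rw [(hT ξ η).2]
  simpa using integral_mono (hT ξ η).1 (integrable_const 1) bound

variable [OpensMeasurableSpace G]

theorem measurable_inner (hU : IsOrthogonalRep U) (ξ η : H) : Measurable fun g => ⟪U g ξ, η⟫ :=
  (hU.continuous ξ η).measurable

theorem integrable_inner (hU : IsOrthogonalRep U) (μ : Measure G) [IsFiniteMeasure μ] (ξ η : H) :
    Integrable (fun g => ⟪U g ξ, η⟫) μ :=
  Integrable.of_bound (hU.measurable_inner ξ η).aestronglyMeasurable (‖ξ‖ * ‖η‖)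
    (Eventually.of_forall fun g => hU.abs_inner_le g ξ η)

theorem exists_isWeakIntegral [CompleteSpace H] (hU : IsOrthogonalRep U) (μ : Measure G)
    [IsFiniteMeasure μ] : ∃ T : H →L[ℝ] H, IsWeakIntegral U μ T := by
  let B : H →ₗ[ℝ] H →ₗ[ℝ] ℝ := LinearMap.mk₂ ℝ (fun ξ η => ∫ g, ⟪U g ξ, η⟫ ∂μ)
    (fun ξ ξ' η => by
      simp only [map_add, inner_add_left]
      exact integral_add (hU.integrable_inner μ _ _) (hU.integrable_inner μ _ _))
    (fun c ξ η => by simp [inner_smul_left, integral_const_mul])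
    (fun ξ η η' => by
      simp only [inner_add_right]
      exact integral_add (hU.integrable_inner μ _ _) (hU.integrable_inner μ _ _))
    (fun c ξ η => by simp [inner_smul_right, integral_const_mul])
  have norm_B_le (ξ η : H) : ‖B ξ η‖ ≤ μ.real Set.univ * ‖ξ‖ * ‖η‖ := by
    rw [mul_assoc, mul_comm]
    exact norm_integral_le_of_norm_le_const (μ := μ) (f := fun g => ⟪U g ξ, η⟫)
      (Eventually.of_forall fun g => hU.abs_inner_le g ξ η)
  obtain ⟨T, hT⟩ := exists_clm_inner_eq B norm_B_le
  exact ⟨T, fun ξ η => ⟨hU.integrable_inner μ ξ η, hT ξ η⟩⟩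

theorem isSymmetric_of_isWeakIntegral [MeasurableInv G] (hU : IsOrthogonalRep U)
    (hT : IsWeakIntegral U μ T) (hμ : μ.map (fun g => g⁻¹) = μ) :
    (T : H →ₗ[ℝ] H).IsSymmetric := fun ξ η => by
  calc ⟪T ξ, η⟫ = ∫ g, ⟪U g ξ, η⟫ ∂(μ.map fun g => g⁻¹) := by rw [hμ, (hT ξ η).2]
    _ = ∫ g, ⟪U g⁻¹ ξ, η⟫ ∂μ := integral_map measurable_inv.aemeasurable
        (hU.measurable_inner ξ η).aestronglyMeasurable
    _ = ∫ g, ⟪U g η, ξ⟫ ∂μ := by simp only [hU.adjoint _ ξ, inv_inv, real_inner_comm]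
    _ = ⟪ξ, T η⟫ := by rw [← (hT η ξ).2, real_inner_comm]

theorem inner_pow_eq_integral_walkLaw [MeasurableMul₂ G] [IsProbabilityMeasure μ]
    (hU : IsOrthogonalRep U) (hT : IsWeakIntegral U μ T) (n : ℕ) (ξ η : H) :
    ⟪(T ^ n) ξ, η⟫ = ∫ g, ⟪U g ξ, η⟫ ∂(walkLaw μ n) := by
  induction n generalizing ξ with
  | zero =>
    rw [walkLaw_zero, integral_dirac' _ _ (hU.measurable_inner ξ η).stronglyMeasurable, hU.one]
    rfl
  | succ n ih =>
    rw [integral_walkLaw_succ μ n (hU.integrable_inner _ ξ η), pow_succ, mul_apply_eq_comp, ih]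
    refine integral_congr_ae (Eventually.of_forall fun g => ?_)
    simp only [hU.mul, hU.adjoint g, (hT _ _).2]

theorem exists_pow_le_integral_walkLaw [MeasurableMul₂ G] [MeasurableInv G]
    [IsProbabilityMeasure μ] (hU : IsOrthogonalRep U) (hT : IsWeakIntegral U μ T)
    (hμ : μ.map (fun g => g⁻¹) = μ) {D : Set H} (hD : Dense D) {φ : G → ℝ}
    (hφ : ∀ n, Integrable φ (walkLaw μ n)) (hφ0 : ∀ g, 0 ≤ φ g)
    (h : ∀ η ∈ D, (fun g => ⟪U g η, η⟫) =O[⊤] φ) {r : ℝ} (hr : 0 ≤ r) (hrT : r < ‖T‖) :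
    ∃ c > 0, ∀ n, c * r ^ (2 * n) ≤ ∫ g, φ g ∂(walkLaw μ (2 * n)) := by
  obtain ⟨η, hηD, hη⟩ := exists_mul_norm_lt_norm_of_dense hD hr hrT
  have norm_pos : 0 < ‖η‖ := norm_pos_iff.2 fun h0 => by simp [h0] at hη
  have symm := hU.isSymmetric_of_isWeakIntegral hT hμ
  have coe_pow (k : ℕ) (ξ : H) : ((T : H →ₗ[ℝ] H) ^ k) ξ = (T ^ k) ξ := by
    rw [← ContinuousLinearMap.toLinearMap_pow, ContinuousLinearMap.coe_coe]
  obtain ⟨C, hC, bound⟩ := (h η hηD).exists_pos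
  have le_mul_φ (g : G) : ⟪U g η, η⟫ ≤ C * φ g := by
    simpa only [Real.norm_of_nonneg (hφ0 g)] using
      (Real.le_norm_self _).trans (Asymptotics.isBigOWith_top.1 bound g)
  refine ⟨‖η‖ ^ 2 / C, by positivity, fun n => ?_⟩
  rw [div_mul_eq_mul_div, div_le_iff₀ hC, mul_comm _ C, ← integral_const_mul]
  calc ‖η‖ ^ 2 * r ^ (2 * n) = (r ^ n * ‖η‖) ^ 2 := by ring
    _ ≤ ‖(T ^ n) η‖ ^ 2 := by
      gcongr
      exact (pow_mul_norm_le_of_isSymmetric symm hr hη.le n).trans_eq (by rw [coe_pow])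
    _ = ∫ g, ⟪U g η, η⟫ ∂(walkLaw μ (2 * n)) := by
      rw [← hU.inner_pow_eq_integral_walkLaw hT, ← coe_pow, ← coe_pow]
      exact (inner_pow_two_mul_of_isSymmetric symm n η).symm
    _ ≤ ∫ g, C * φ g ∂(walkLaw μ (2 * n)) :=
      integral_mono (hU.integrable_inner _ _ _) ((hφ _).const_mul C) le_mul_φ

end IsOrthogonalRep

/-! ### Laplace transforms along the random walk -/

theorem mgf_add_le_rpow_mul_rpow {Ω : Type*} [MeasurableSpace Ω] {μ : Measure Ω} {X : Ω → ℝ}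
    {s t a b : ℝ} (hs : s ∈ integrableExpSet X μ) (ht : t ∈ integrableExpSet X μ) (ha : 0 < a)
    (hb : 0 < b) (hab : a + b = 1) :
    mgf X μ (a * s + b * t) ≤ mgf X μ s ^ a * mgf X μ t ^ b := by
  have conjugate : (a⁻¹).HolderConjugate b⁻¹ :=
    Real.holderConjugate_iff.2 ⟨(one_lt_inv₀ ha).2 (by linarith), by simpa using hab⟩
  have exp_rpow {u c : ℝ} (hc : 0 < c) (ω : Ω) :
      Real.exp (c * u * X ω) ^ c⁻¹ = Real.exp (u * X ω) := by
    rw [← Real.exp_mul]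
    congr 1
    field_simp
  have memLp {u c : ℝ} (hc : 0 < c) (hu : u ∈ integrableExpSet X μ) :
      MemLp (fun ω => Real.exp (c * u * X ω)) (ENNReal.ofReal c⁻¹) μ := by
    have aesm : AEStronglyMeasurable (fun ω => Real.exp (c * u * X ω)) μ := by
      have := (hu.aestronglyMeasurable.aemeasurable.pow_const c).aestronglyMeasurable
      simpa only [← Real.exp_mul, mul_comm, mul_left_comm] using this
    rw [← integrable_norm_rpow_iff aesm (by simpa using hc) ENNReal.ofReal_ne_top,
      ENNReal.toReal_ofReal (by positivity)]
    simpa only [Real.norm_eq_abs, Real.abs_exp, exp_rpow hc, integrableExpSet,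
      Set.mem_ofPred_eq] using hu
  have holder := integral_mul_le_Lp_mul_Lq_of_nonneg conjugate
    (Eventually.of_forall fun ω => (Real.exp_pos _).le)
    (Eventually.of_forall fun ω => (Real.exp_pos _).le) (memLp ha hs) (memLp hb ht)
  simpa only [mgf, exp_rpow ha, exp_rpow hb, one_div, inv_inv, ← Real.exp_add, ← add_mul]
    using holder

theorem convexOn_cgf {Ω : Type*} [MeasurableSpace Ω] {X : Ω → ℝ} {μ : Measure Ω} :
    ConvexOn ℝ (integrableExpSet X μ) (cgf X μ) := by
  rcases eq_or_ne μ 0 with rfl | hμ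
  · rw [cgf_zero_measure]
    exact convexOn_const 0 convex_integrableExpSet
  refine convexOn_iff_forall_pos.2 ⟨convex_integrableExpSet, fun s hs t ht a b ha hb hab => ?_⟩
  have combo_mem : a * s + b * t ∈ integrableExpSet X μ :=
    convex_integrableExpSet hs ht ha.le hb.le hab
  have mgf_s_pos := mgf_pos' hμ hs
  have mgf_t_pos := mgf_pos' hμ ht
  simp only [cgf, smul_eq_mul]
  rw [← Real.log_rpow mgf_s_pos, ← Real.log_rpow mgf_t_pos,
    ← Real.log_mul (by positivity) (by positivity)]
  exact Real.log_le_log (mgf_pos' hμ combo_mem) (mgf_add_le_rpow_mul_rpow hs ht ha hb hab)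

theorem exists_mul_add_sq_le {c : ℝ} (hc0 : 0 ≤ c) (hc1 : c < 1) :
    ∃ C : ℝ, 0 ≤ C ∧ ∀ x y : ℝ, c * (x + y) ^ 2 ≤ x ^ 2 + C * y ^ 2 := by
  have h : 0 < 1 - c := sub_pos.2 hc1
  refine ⟨c / (1 - c), by positivity, fun x y => sub_nonneg.1 ?_⟩
  have square : x ^ 2 + c / (1 - c) * y ^ 2 - c * (x + y) ^ 2
      = ((1 - c) * x - c * y) ^ 2 / (1 - c) := by
    field_simp
    ring
  rw [square]
  positivity

theorem exp_neg_mul_sq_le_one {s : ℝ} (hs : 0 ≤ s) (x : ℝ) : Real.exp (-s * x ^ 2) ≤ 1 := by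
  rw [Real.exp_le_one_iff, neg_mul, Left.neg_nonpos_iff]
  positivity

theorem integrable_exp_neg_mul_sq_comp {Ω : Type*} [MeasurableSpace Ω] {X : Ω → ℝ}
    {ν : Measure Ω} [IsFiniteMeasure ν] (hX : AEMeasurable X ν) {s : ℝ} (hs : 0 ≤ s) :
    Integrable (fun ω => Real.exp (-s * X ω ^ 2)) ν :=
  Integrable.of_bound (by fun_prop) 1 (Eventually.of_forall fun ω => by
    simpa only [Real.norm_eq_abs, Real.abs_exp] using exp_neg_mul_sq_le_one hs (X ω))

theorem tendsto_rpow_one_div_of_pow_le {x : ℕ → ℝ} {R : ℝ} (hR : 0 < R) (hx : ∀ n, 0 ≤ x n)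
    (hle : ∀ n, x n ≤ R ^ n) (hge : ∀ r, 0 < r → r < R → ∃ k > 0, ∀ n, k * r ^ n ≤ x n) :
    Tendsto (fun n : ℕ => x n ^ (1 / (n : ℝ))) atTop (𝓝 R) := by
  refine tendsto_order.2 ⟨fun q hq => ?_, fun q hq => ?_⟩
  · obtain ⟨r, hqr, hrR⟩ := exists_between (max_lt hq hR)
    have hr : 0 < r := (le_max_right _ _).trans_lt hqr
    obtain ⟨k, hk, hkx⟩ := hge r hr hrR
    have root_lim : Tendsto (fun n : ℕ => k ^ (1 / (n : ℝ)) * r) atTop (𝓝 (k ^ (0 : ℝ) * r)) :=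
      (tendsto_const_nhds.rpow tendsto_one_div_atTop_nhds_zero_nat (Or.inl hk.ne')).mul_const r
    rw [Real.rpow_zero, one_mul] at root_lim
    filter_upwards [root_lim.eventually (lt_mem_nhds ((le_max_left _ _).trans_lt hqr)),
      eventually_ne_atTop 0] with n hn hn0
    calc q < k ^ (1 / (n : ℝ)) * r := hn
      _ = (k * r ^ n) ^ (1 / (n : ℝ)) := by
        rw [Real.mul_rpow hk.le (by positivity), one_div, Real.pow_rpow_inv_natCast hr.le hn0]
      _ ≤ x n ^ (1 / (n : ℝ)) := by
        gcongr
        exact hkx n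
  · filter_upwards [eventually_ne_atTop 0] with n hn0
    calc x n ^ (1 / (n : ℝ)) ≤ (R ^ n) ^ (1 / (n : ℝ)) := by
          gcongr
          exacts [hx n, hle n]
      _ = R := by rw [one_div, Real.pow_rpow_inv_natCast hR.le hn0]
      _ < q := hq

theorem exists_rpow_sq_lt {r R : ℝ} (hr : 0 < r) (hrR : r < R) :
    ∃ c : ℝ, 0 < c ∧ c < 1 ∧ r ^ (c ^ 2) < R := by
  have rpow_lim : Tendsto (fun c : ℝ => r ^ (c ^ 2)) (𝓝[<] 1) (𝓝 (r ^ ((1 : ℝ) ^ 2))) :=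
    ((continuous_const.rpow (continuous_pow 2) fun _ => Or.inl hr.ne').tendsto 1).mono_left
      nhdsWithin_le_nhds
  rw [one_pow, Real.rpow_one] at rpow_lim
  have eventually_pos : ∀ᶠ c : ℝ in 𝓝[<] 1, 0 < c :=
    nhdsWithin_le_nhds (lt_mem_nhds zero_lt_one)
  obtain ⟨c, ⟨hcR, hc0⟩, hc1⟩ := ((rpow_lim.eventually (gt_mem_nhds hrR)).and eventually_pos).and
    self_mem_nhdsWithin |>.exists
  exact ⟨c, hc0, hc1, hcR⟩

/-- The Laplace transform `s ↦ 𝔼 exp (-s ℓ(g_n)²)` of the square of a function `ℓ` after `n` steps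
of the random walk. -/
noncomputable def walkLaplace {G : Type*} [Group G] [MeasurableSpace G] (μ : Measure G) (ℓ : G → ℝ)
    (n : ℕ) (s : ℝ) : ℝ :=
  walkExpectation μ n fun g => Real.exp (-s * ℓ g ^ 2)

section WalkLaplace

variable {G : Type*} [Group G] [MeasurableSpace G] [MeasurableMul₂ G] {μ : Measure G} {ℓ : G → ℝ}

theorem walkLaplace_eq_integral (hℓ : Measurable ℓ) (n : ℕ) (s : ℝ) :
    walkLaplace μ ℓ n s = ∫ g, Real.exp (-s * ℓ g ^ 2) ∂(walkLaw μ n) :=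
  walkExpectation_eq_integral_walkLaw μ n (by fun_prop)

variable [IsProbabilityMeasure μ]

theorem walkLaplace_zero (hℓ : Measurable ℓ) (n : ℕ) : walkLaplace μ ℓ n 0 = 1 := by
  simp [walkLaplace_eq_integral hℓ]

theorem walkLaplace_pos (hℓ : Measurable ℓ) (n : ℕ) {s : ℝ} (hs : 0 ≤ s) :
    0 < walkLaplace μ ℓ n s := by
  rw [walkLaplace_eq_integral hℓ]
  exact integral_exp_pos (integrable_exp_neg_mul_sq_comp hℓ.aemeasurable hs)

theorem antitoneOn_walkLaplace (hℓ : Measurable ℓ) (n : ℕ) :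
    AntitoneOn (walkLaplace μ ℓ n) (Set.Ici 0) := fun s hs t ht hst => by
  rw [walkLaplace_eq_integral hℓ, walkLaplace_eq_integral hℓ]
  refine integral_mono (integrable_exp_neg_mul_sq_comp hℓ.aemeasurable ht)
    (integrable_exp_neg_mul_sq_comp hℓ.aemeasurable hs) fun g => ?_
  beta_reduce
  gcongr

theorem convexOn_log_walkLaplace (hℓ : Measurable ℓ) (n : ℕ) :
    ConvexOn ℝ (Set.Ici 0) fun s => Real.log (walkLaplace μ ℓ n s) := by
  refine ((convexOn_cgf (X := fun g => ℓ g ^ 2) (μ := walkLaw μ n)).comp_linearMap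
    (-LinearMap.id)).subset (fun s hs => ?_) (convex_Ici 0) |>.congr fun s _ => ?_
  · exact integrable_exp_neg_mul_sq_comp hℓ.aemeasurable hs
  · rw [walkLaplace_eq_integral hℓ]
    rfl

theorem walkLaplace_mul_le_rpow (hℓ : Measurable ℓ) (n : ℕ) {s c : ℝ} (hs : 0 ≤ s) (hc0 : 0 ≤ c)
    (hc1 : c ≤ 1) : walkLaplace μ ℓ n (c * s) ≤ walkLaplace μ ℓ n s ^ c := by
  have laplace_pos := walkLaplace_pos (μ := μ) hℓ n hs
  have log_convex := (convexOn_log_walkLaplace (μ := μ) hℓ n).2 (x := s) (y := 0) hs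
    Set.self_mem_Ici hc0 (sub_nonneg.2 hc1) (by ring)
  simp only [walkLaplace_zero hℓ, smul_eq_mul, Real.log_one, mul_zero, add_zero] at log_convex
  rwa [← Real.log_rpow laplace_pos, Real.log_le_log_iff (walkLaplace_pos hℓ n (by positivity))
    (by positivity)] at log_convex

theorem exists_mul_walkLaplace_le_succ (hℓ : Measurable ℓ) (h0 : ∀ g, 0 ≤ ℓ g)
    (hadd : ∀ g h, ℓ (g * h) ≤ ℓ g + ℓ h) {s c : ℝ} (hs : 0 ≤ s) (hc0 : 0 ≤ c) (hc1 : c < 1) :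
    ∃ k > 0, ∀ n, k * walkLaplace μ ℓ n s ≤ walkLaplace μ ℓ (n + 1) (c * s) := by
  obtain ⟨C, hC, mul_add_sq_le⟩ := exists_mul_add_sq_le hc0 hc1
  have integrable_C : Integrable (fun h => Real.exp (-(s * C) * ℓ h ^ 2)) μ :=
    integrable_exp_neg_mul_sq_comp hℓ.aemeasurable (by positivity)
  refine ⟨∫ h, Real.exp (-(s * C) * ℓ h ^ 2) ∂μ, integral_exp_pos integrable_C, fun n => ?_⟩
  have pointwise (g h : G) : Real.exp (-(s * C) * ℓ h ^ 2) * Real.exp (-s * ℓ g ^ 2)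
      ≤ Real.exp (-(c * s) * ℓ (g * h) ^ 2) := by
    rw [← Real.exp_add, Real.exp_le_exp]
    have sq_le : ℓ (g * h) ^ 2 ≤ (ℓ g + ℓ h) ^ 2 := pow_le_pow_left₀ (h0 _) (hadd g h) 2
    nlinarith [mul_le_mul_of_nonneg_left
      ((mul_le_mul_of_nonneg_left sq_le hc0).trans (mul_add_sq_le (ℓ g) (ℓ h))) hs]
  calc (∫ h, Real.exp (-(s * C) * ℓ h ^ 2) ∂μ) * walkLaplace μ ℓ n s
      = ∫ x : G × G, Real.exp (-s * ℓ x.1 ^ 2) * Real.exp (-(s * C) * ℓ x.2 ^ 2)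
          ∂((walkLaw μ n).prod μ) := by
        rw [walkLaplace_eq_integral hℓ, mul_comm]
        exact (integral_prod_mul _ _).symm
    _ ≤ ∫ x : G × G, Real.exp (-(c * s) * ℓ (x.1 * x.2) ^ 2) ∂((walkLaw μ n).prod μ) := by
        refine integral_mono
          ((integrable_exp_neg_mul_sq_comp hℓ.aemeasurable hs).mul_prod integrable_C)
          (integrable_exp_neg_mul_sq_comp (X := fun x : G × G => ℓ (x.1 * x.2)) (by fun_prop)
            (by positivity)) fun x => ?_
        rw [mul_comm]
        exact pointwise x.1 x.2
    _ = walkLaplace μ ℓ (n + 1) (c * s) := by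
        rw [walkLaplace_eq_integral hℓ, walkLaw_succ]
        have measurable_exp : Measurable fun g => Real.exp (-(c * s) * ℓ g ^ 2) := by fun_prop
        exact (integral_map measurable_mul.aemeasurable measurable_exp.aestronglyMeasurable).symm

theorem exists_pow_le_walkLaplace (hℓ : Measurable ℓ) (h0 : ∀ g, 0 ≤ ℓ g)
    (hadd : ∀ g h, ℓ (g * h) ≤ ℓ g + ℓ h) {s r c : ℝ} (hs : 0 ≤ s) (hr0 : 0 ≤ r) (hr1 : r ≤ 1)
    (hc0 : 0 ≤ c) (hc1 : c < 1)
    (heven : ∃ k > 0, ∀ n, k * r ^ (2 * n) ≤ walkLaplace μ ℓ (2 * n) s) :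
    ∃ k > 0, ∀ n, k * r ^ n ≤ walkLaplace μ ℓ n (c * s) := by
  obtain ⟨k, hk, le_even⟩ := heven
  obtain ⟨k', hk', le_succ⟩ := exists_mul_walkLaplace_le_succ (μ := μ) hℓ h0 hadd hs hc0 hc1
  refine ⟨min k (k' * k), by positivity, fun n => ?_⟩
  rcases Nat.even_or_odd' n with ⟨m, rfl | rfl⟩
  · calc min k (k' * k) * r ^ (2 * m) ≤ k * r ^ (2 * m) := by
          gcongr
          exact min_le_left _ _
      _ ≤ walkLaplace μ ℓ (2 * m) s := le_even m
      _ ≤ walkLaplace μ ℓ (2 * m) (c * s) := antitoneOn_walkLaplace hℓ _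
          (mul_nonneg hc0 hs) hs (mul_le_of_le_one_left hs hc1.le)
  · calc min k (k' * k) * r ^ (2 * m + 1) ≤ k' * k * r ^ (2 * m) :=
          mul_le_mul (min_le_right _ _) (pow_le_pow_of_le_one hr0 hr1 (Nat.le_succ _))
            (by positivity) (by positivity)
      _ = k' * (k * r ^ (2 * m)) := mul_assoc _ _ _
      _ ≤ k' * walkLaplace μ ℓ (2 * m) s := by
          gcongr
          exact le_even m
      _ ≤ walkLaplace μ ℓ (2 * m + 1) (c * s) := le_succ _

/-- The lower bound is only needed at `c * s` with `c < 1`: log-convexity bounds the transform at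
`c * s` by the `c`-th power of its value at `s`, and `c → 1`. -/
theorem tendsto_walkLaplace_rpow (hℓ : Measurable ℓ) (h0 : ∀ g, 0 ≤ ℓ g)
    (hadd : ∀ g h, ℓ (g * h) ≤ ℓ g + ℓ h) {s R : ℝ} (hs : 0 ≤ s) (hR : R ≤ 1)
    (hle : ∀ n, walkLaplace μ ℓ n s ≤ R ^ n)
    (hge : ∀ c r : ℝ, 0 < c → c < 1 → 0 ≤ r → r < R →
      ∃ k > 0, ∀ n, k * r ^ (2 * n) ≤ walkLaplace μ ℓ (2 * n) (c * s)) :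
    Tendsto (fun n : ℕ => walkLaplace μ ℓ n s ^ (1 / (n : ℝ))) atTop (𝓝 R) := by
  have laplace_pos (n : ℕ) := walkLaplace_pos (μ := μ) hℓ n hs
  have hR0 : 0 < R := by simpa only [pow_one] using (laplace_pos 1).trans_le (hle 1)
  refine tendsto_rpow_one_div_of_pow_le hR0 (fun n => (laplace_pos n).le) hle fun r hr hrR => ?_
  obtain ⟨c, hc0, hc1, hcR⟩ := exists_rpow_sq_lt hr hrR
  obtain ⟨k, hk, le_laplace⟩ := exists_pow_le_walkLaplace hℓ h0 hadd (mul_nonneg hc0.le hs)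
    (by positivity) (hcR.le.trans hR) hc0.le hc1 (hge c _ hc0 hc1 (by positivity) hcR)
  refine ⟨k ^ (c ^ 2)⁻¹, by positivity, fun n => ?_⟩
  have laplace_nonneg := (laplace_pos n).le
  rw [← Real.rpow_le_rpow_iff (by positivity) laplace_nonneg (by positivity : 0 < c ^ 2)]
  calc (k ^ (c ^ 2)⁻¹ * r ^ n) ^ (c ^ 2) = k * (r ^ (c ^ 2)) ^ n := by
        rw [Real.mul_rpow (by positivity) (by positivity),
          Real.rpow_inv_rpow hk.le (by positivity), Real.rpow_pow_comm hr.le]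
    _ ≤ walkLaplace μ ℓ n (c * (c * s)) := le_laplace n
    _ = walkLaplace μ ℓ n (c ^ 2 * s) := by ring_nf
    _ ≤ walkLaplace μ ℓ n s ^ (c ^ 2) :=
        walkLaplace_mul_le_rpow hℓ n hs (by positivity) (pow_le_one₀ hc0.le hc1.le)

end WalkLaplace

/-! ### Representations carrying a Gaussian kernel -/

/-- The vectors `ξ a`, `a ∈ P`, are total and realize the kernel `exp (-d(a, b)² / 8)`. -/
structure IsGaussianKernel {P H : Type*} [PseudoMetricSpace P] [NormedAddCommGroup H]
    [InnerProductSpace ℝ H] (ξ : P → H) : Prop where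
  inner : ∀ a b, ⟪ξ a, ξ b⟫ = Real.exp (-(dist a b ^ 2) / 8)
  dense : Dense (Submodule.span ℝ (Set.range ξ) : Set H)

namespace AffineIsometricAction

variable {G V P : Type*} [Group G] [TopologicalSpace G] [NormedAddCommGroup V]
  [InnerProductSpace ℝ V] [MetricSpace P] [NormedAddTorsor V P] (β : AffineIsometricAction G P)

theorem hom_mul_apply (g h : G) (x : P) : β.hom (g * h) x = β.hom g (β.hom h x) := by
  rw [map_mul]
  rfl

theorem hom_one_apply (x : P) : β.hom 1 x = x := by
  rw [map_one]
  rfl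

theorem dist_hom (g : G) (x y : P) : dist (β.hom g x) y = dist x (β.hom g⁻¹ y) := by
  rw [← (β.hom g).dist_map x, ← hom_mul_apply, mul_inv_cancel, hom_one_apply]

theorem norm_cocycle (x : P) (g : G) : ‖β.cocycle x g‖ = dist (β.hom g x) x :=
  (dist_eq_norm_vsub V _ _).symm

theorem norm_cocycle_mul_le (x : P) (g h : G) :
    ‖β.cocycle x (g * h)‖ ≤ ‖β.cocycle x g‖ + ‖β.cocycle x h‖ := by
  simp only [norm_cocycle, hom_mul_apply]
  rw [add_comm, ← (β.hom g).dist_map (β.hom h x)]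
  exact dist_triangle _ _ _

theorem continuous_norm_cocycle (x : P) : Continuous fun g => ‖β.cocycle x g‖ := by
  simp only [norm_cocycle]
  exact (β.continuous_orbit x).dist continuous_const

theorem measurable_norm_cocycle [MeasurableSpace G] [OpensMeasurableSpace G] (x : P) :
    Measurable fun g => ‖β.cocycle x g‖ :=
  (β.continuous_norm_cocycle x).measurable

theorem isBigO_exp_neg_dist_sq (x a b : P) {c : ℝ} (hc0 : 0 ≤ c) (hc1 : c < 1) :
    (fun g => Real.exp (-(dist (β.hom g a) b ^ 2) / 8)) =O[⊤]
      fun g => Real.exp (-(c * (1 / 8)) * ‖β.cocycle x g‖ ^ 2) := by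
  obtain ⟨C, -, mul_add_sq_le⟩ := exists_mul_add_sq_le hc0 hc1
  refine Asymptotics.isBigO_top.2
    ⟨Real.exp (C * (dist x a + dist x b) ^ 2 / 8), fun g => ?_⟩
  rw [Real.norm_eq_abs, Real.norm_eq_abs, Real.abs_exp, Real.abs_exp, ← Real.exp_add,
    Real.exp_le_exp, norm_cocycle]
  have dist_le : dist (β.hom g x) x ≤ dist (β.hom g a) b + (dist x a + dist x b) := by
    have := dist_triangle4 (β.hom g x) (β.hom g a) b x
    rw [(β.hom g).dist_map, dist_comm b] at this
    linarith
  have : c * dist (β.hom g x) x ^ 2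
      ≤ dist (β.hom g a) b ^ 2 + C * (dist x a + dist x b) ^ 2 :=
    (by gcongr : _ ≤ c * (dist (β.hom g a) b + (dist x a + dist x b)) ^ 2).trans
      (mul_add_sq_le _ _)
  linarith

end AffineIsometricAction

namespace IsGaussianKernel

variable {P H : Type*} [MetricSpace P] [NormedAddCommGroup H] [InnerProductSpace ℝ H] {ξ : P → H}

theorem norm_eq_one (hξ : IsGaussianKernel ξ) (a : P) : ‖ξ a‖ = 1 := by
  rw [← sq_eq_sq₀ (norm_nonneg _) zero_le_one, ← real_inner_self_eq_norm_sq, hξ.inner]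
  simp

variable {G V : Type*} [Group G] [TopologicalSpace G] [NormedAddCommGroup V]
  [InnerProductSpace ℝ V] [NormedAddTorsor V P] {β : AffineIsometricAction G P} {U : G → H →L[ℝ] H}

theorem inner_map (hξ : IsGaussianKernel ξ) (hU : ∀ g a, U g (ξ a) = ξ (β.hom g a)) (g : G)
    (a b : P) : ⟪U g (ξ a), ξ b⟫ = Real.exp (-(dist (β.hom g a) b ^ 2) / 8) := by
  rw [hU, hξ.inner]

theorem inner_map_self (hξ : IsGaussianKernel ξ) (hU : ∀ g a, U g (ξ a) = ξ (β.hom g a)) (g : G)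
    (x : P) : ⟪U g (ξ x), ξ x⟫ = Real.exp (-(1 / 8) * ‖β.cocycle x g‖ ^ 2) := by
  rw [hξ.inner_map hU, β.norm_cocycle]
  ring_nf

theorem isOrthogonalRep (hξ : IsGaussianKernel ξ) (hU : ∀ g a, U g (ξ a) = ξ (β.hom g a)) :
    IsOrthogonalRep U := by
  refine .of_dense_span hξ.dense ?_ ?_ ?_ ?_
  · rintro _ ⟨a, rfl⟩
    rw [hU, β.hom_one_apply]
  · rintro g h _ ⟨a, rfl⟩
    rw [hU, hU, hU, β.hom_mul_apply]
  · rintro g _ ⟨a, rfl⟩ _ ⟨b, rfl⟩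
    rw [hU, hU, hξ.inner, hξ.inner, β.dist_hom]
  · rintro _ ⟨a, rfl⟩ _ ⟨b, rfl⟩
    simp only [hξ.inner_map hU]
    have := (β.continuous_orbit a).dist (continuous_const (y := b))
    fun_prop

variable [MeasurableSpace G] {μ : Measure G} [IsProbabilityMeasure μ]

theorem walkLaplace_le_norm_pow [OpensMeasurableSpace G] [MeasurableMul₂ G]
    (hξ : IsGaussianKernel ξ) (hU : ∀ g a, U g (ξ a) = ξ (β.hom g a)) {T : H →L[ℝ] H}
    (hT : IsWeakIntegral U μ T) (x : P) (n : ℕ) :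
    walkLaplace μ (fun g => ‖β.cocycle x g‖) n (1 / 8) ≤ ‖T‖ ^ n := by
  rw [walkLaplace_eq_integral (β.measurable_norm_cocycle x)]
  simp only [← hξ.inner_map_self hU]
  rw [← (hξ.isOrthogonalRep hU).inner_pow_eq_integral_walkLaw hT]
  calc ⟪(T ^ n) (ξ x), ξ x⟫ ≤ ‖(T ^ n) (ξ x)‖ * ‖ξ x‖ := real_inner_le_norm _ _
    _ ≤ ‖T ^ n‖ * ‖ξ x‖ * ‖ξ x‖ := by
      gcongr
      exact (T ^ n).le_opNorm _
    _ = ‖T ^ n‖ := by rw [hξ.norm_eq_one, mul_one, mul_one]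
    _ ≤ ‖T‖ ^ n := by
      rcases n with _ | n
      · exact ContinuousLinearMap.norm_id_le
      · exact norm_pow_le' T n.succ_pos

theorem tendsto_walkLaplace_rpow_opNorm [OpensMeasurableSpace G] [MeasurableMul₂ G]
    [MeasurableInv G] (hξ : IsGaussianKernel ξ) (hU : ∀ g a, U g (ξ a) = ξ (β.hom g a))
    {T : H →L[ℝ] H} (hT : IsWeakIntegral U μ T) (hμ : μ.map (fun g => g⁻¹) = μ) (x : P) :
    Tendsto (fun n : ℕ => walkLaplace μ (fun g => ‖β.cocycle x g‖) n (1 / 8) ^ (1 / (n : ℝ)))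
      atTop (𝓝 ‖T‖) := by
  have rep := hξ.isOrthogonalRep hU
  have meas := β.measurable_norm_cocycle x
  refine tendsto_walkLaplace_rpow meas (fun g => norm_nonneg _) (β.norm_cocycle_mul_le x)
    (by norm_num) (rep.norm_le_one_of_isWeakIntegral hT) (hξ.walkLaplace_le_norm_pow hU hT x)
    fun c r hc0 hc1 hr hrT => ?_
  simp only [walkLaplace_eq_integral meas]
  refine rep.exists_pow_le_integral_walkLaw hT hμ hξ.dense
    (fun n => integrable_exp_neg_mul_sq_comp meas.aemeasurable (by positivity))
    (fun g => (Real.exp_pos _).le) (fun η hη => isBigO_inner_of_mem_span ?_ hη hη) hr hrT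
  rintro _ ⟨a, rfl⟩ _ ⟨b, rfl⟩
  simpa only [hξ.inner_map hU] using β.isBigO_exp_neg_dist_sq x a b hc0.le hc1

theorem exists_hasSpectralRadius [OpensMeasurableSpace G] [MeasurableMul₂ G] [MeasurableInv G]
    [CompleteSpace H] (hξ : IsGaussianKernel ξ) (hU : ∀ g a, U g (ξ a) = ξ (β.hom g a))
    (hμ : μ.map (fun g => g⁻¹) = μ) :
    ∃ r, HasSpectralRadius U μ r ∧ ∀ x : P,
      (∀ n, walkLaplace μ (fun g => ‖β.cocycle x g‖) n (1 / 8) ≤ r ^ n) ∧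
      Tendsto (fun n : ℕ => walkLaplace μ (fun g => ‖β.cocycle x g‖) n (1 / 8) ^ (1 / (n : ℝ)))
        atTop (𝓝 r) := by
  have rep := hξ.isOrthogonalRep hU
  obtain ⟨T, hT⟩ := rep.exists_isWeakIntegral μ
  exact ⟨‖T‖, ⟨T, hT, rfl⟩, fun x => ⟨hξ.walkLaplace_le_norm_pow hU hT x,
    hξ.tendsto_walkLaplace_rpow_opNorm hU hT hμ x⟩⟩

end IsGaussianKernel

/-! ### Koopman representations of Gaussian actions -/

section SqrtDensity

variable {X : Type*} [MeasurableSpace X]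

theorem memLp_sqrt_rnDeriv (p η : Measure X) [IsFiniteMeasure η] :
    MemLp (fun ω => Real.sqrt (η.rnDeriv p ω).toReal) 2 p := by
  have meas := (Measure.measurable_rnDeriv η p).ennreal_toReal.sqrt
  rw [memLp_two_iff_integrable_sq meas.aestronglyMeasurable]
  simp only [Real.sq_sqrt ENNReal.toReal_nonneg]
  exact Measure.integrable_toReal_rnDeriv

/-- The square root `√(dη/dp)` of the density of a finite measure `η` in `L²(p)`. Koopman
operators act on it by pushing `η` forward. -/
noncomputable def sqrtDensityLp (p η : Measure X) [IsFiniteMeasure η] : Lp ℝ 2 p :=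
  (memLp_sqrt_rnDeriv p η).toLp _

theorem coeFn_sqrtDensityLp (p η : Measure X) [IsFiniteMeasure η] :
    sqrtDensityLp p η =ᵐ[p] fun ω => Real.sqrt (η.rnDeriv p ω).toReal :=
  (memLp_sqrt_rnDeriv p η).coeFn_toLp

theorem setIntegral_sqrtDensityLp_sq (p η : Measure X) [SigmaFinite p] [IsFiniteMeasure η]
    (hη : η ≪ p) (S : Set X) : ∫ ω in S, sqrtDensityLp p η ω ^ 2 ∂p = η.real S := by
  rw [← Measure.setIntegral_toReal_rnDeriv hη S]
  refine integral_congr_ae (ae_restrict_of_ae ?_)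
  filter_upwards [coeFn_sqrtDensityLp p η] with ω sqrt_ω
  rw [sqrt_ω, Real.sq_sqrt ENNReal.toReal_nonneg]

end SqrtDensity

namespace NonsingularAction

variable {G X : Type*} [Group G] [TopologicalSpace G] [MeasurableSpace X] {ν : Measure X}

theorem map_withDensity_act (A : NonsingularAction G X ν) (g : G) {D : X → ℝ≥0∞}
    (hD : Measurable D) :
    (ν.withDensity D).map (A.act g)
      = (ν.map (A.act g)).withDensity fun ω => D (A.act g⁻¹ ω) := by
  have meas := (A.quasi g).measurable
  have meas_inv := (A.quasi g⁻¹).measurable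
  ext S hS
  rw [withDensity_apply _ hS, Measure.map_apply meas hS, withDensity_apply _ (meas hS),
    ← lintegral_indicator hS, lintegral_map (Measurable.indicator (by fun_prop) hS) meas,
    ← lintegral_indicator (meas hS)]
  refine lintegral_congr_ae ?_
  filter_upwards [A.mul_ae g⁻¹ g, A.one_ae] with ω mul_ω one_ω
  rw [inv_mul_cancel, one_ω] at mul_ω
  simp only [Set.indicator, ← mul_ω]
  rfl

theorem rnDeriv_map_act_ae_eq [SigmaFinite ν] (A : NonsingularAction G X ν) (g : G)
    [IsFiniteMeasure (ν.map (A.act g))] {η : Measure X} [SigmaFinite η] (hη : η ≪ ν) :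
    (η.map (A.act g)).rnDeriv ν =ᵐ[ν]
      fun ω => (ν.map (A.act g)).rnDeriv ν ω * η.rnDeriv ν (A.act g⁻¹ ω) := by
  have meas := Measure.measurable_rnDeriv η ν
  have meas_comp := meas.comp (A.quasi g⁻¹).measurable
  have map_eq : η.map (A.act g)
      = ν.withDensity ((ν.map (A.act g)).rnDeriv ν * (η.rnDeriv ν ∘ A.act g⁻¹)) := by
    rw [withDensity_mul _ (Measure.measurable_rnDeriv _ _) meas_comp,
      Measure.withDensity_rnDeriv_eq _ _ (A.quasi g).absolutelyContinuous, Function.comp_def,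
      ← A.map_withDensity_act g meas, Measure.withDensity_rnDeriv_eq _ _ hη]
  rw [map_eq]
  exact Measure.rnDeriv_withDensity _ ((Measure.measurable_rnDeriv _ _).mul meas_comp)

theorem koopman_sqrtDensityLp [IsProbabilityMeasure ν] (A : NonsingularAction G X ν) (g : G)
    {η : Measure X} [IsFiniteMeasure η] (hη : η ≪ ν) :
    A.koopman g (sqrtDensityLp ν η) = sqrtDensityLp ν (η.map (A.act g)) := by
  change (A.memLp_koopmanFun g (Lp.memLp (sqrtDensityLp ν η))).toLp _ = _
  refine MemLp.toLp_congr _ _ ((A.koopmanFun_congr g (coeFn_sqrtDensityLp ν η)).trans ?_)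
  filter_upwards [A.rnDeriv_map_act_ae_eq g hη] with ω density_ω
  rw [density_ω, ENNReal.toReal_mul, Real.sqrt_mul ENNReal.toReal_nonneg, koopmanFun]

end NonsingularAction

namespace IsIsonormal

variable {V X : Type*} [NormedAddCommGroup V] [InnerProductSpace ℝ V] [MeasurableSpace X]
  {W : V → X → ℝ} {p : Measure X}

theorem halfDensityLp_eq_sqrtDensityLp (h : IsIsonormal W p) (v : V)
    [IsFiniteMeasure (shiftMeasure W p v)] :
    h.halfDensityLp v = sqrtDensityLp p (shiftMeasure W p v) := by
  have := h.isProbabilityMeasure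
  refine Lp.ext ?_
  filter_upwards [h.coeFn_halfDensityLp v, coeFn_sqrtDensityLp p (shiftMeasure W p v),
    Measure.rnDeriv_withDensity p (h.measurable_cameronMartin v).ennreal_ofReal]
    with ω half_ω sqrt_ω density_ω
  rw [half_ω, sqrt_ω, halfDensity_eq_sqrt, shiftMeasure, density_ω, cameronMartin,
    ENNReal.toReal_ofReal (Real.exp_pos _).le]

theorem koopman_halfDensityLp [IsProbabilityMeasure p] (h : IsIsonormal W p) {G : Type*} [Group G]
    [TopologicalSpace G] (A : NonsingularAction G X p) (g : G) {u v : V}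
    (huv : (shiftMeasure W p u).map (A.act g) = shiftMeasure W p v) :
    A.koopman g (h.halfDensityLp u) = h.halfDensityLp v := by
  have := h.isProbabilityMeasure_shiftMeasure
  simp only [h.halfDensityLp_eq_sqrtDensityLp,
    A.koopman_sqrtDensityLp g (shiftMeasure_absolutelyContinuous W p u), huv]

theorem isGaussianKernel (h : IsIsonormal W p) {P : Type*} [MetricSpace P] [NormedAddTorsor V P]
    (y : P) : IsGaussianKernel fun a : P => h.halfDensityLp (a -ᵥ y) where
  inner a b := by
    rw [h.inner_halfDensityLp, vsub_sub_vsub_cancel_right, dist_eq_norm_vsub V]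
  dense := by
    have range_eq : Set.range (fun a : P => h.halfDensityLp (a -ᵥ y))
        = Set.range h.halfDensityLp :=
      (Equiv.vaddConst y).symm.surjective.range_comp h.halfDensityLp
    rw [range_eq, Submodule.dense_iff_topologicalClosure_eq_top]
    exact h.topologicalClosure_span_halfDensityLp

end IsIsonormal

/-! ### Gaussian densities as isonormal processes -/

section AffineInner

variable {V P : Type*} [NormedAddCommGroup V] [InnerProductSpace ℝ V] [MetricSpace P]
  [NormedAddTorsor V P]

/-- The affine function `x ↦ ⟪v, x - y⟫`. Its image in a Gaussian density over `P` is the variable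
indexed by `v` of an isonormal process under `m y`. -/
noncomputable def affineInner (y : P) (v : V) : P →ᴬ[ℝ] ℝ where
  toFun x := ⟪v, x -ᵥ y⟫
  linear := innerₗ V v
  map_vadd' x w := by
    simp [vadd_vsub_assoc, inner_add_right]
  cont := by fun_prop

theorem affineInner_apply (y : P) (v : V) (x : P) : affineInner y v x = ⟪v, x -ᵥ y⟫ := rfl

theorem nnnorm_contLinear_affineInner (y : P) (v : V) : ‖(affineInner y v).contLinear‖₊ = ‖v‖₊ :=
  NNReal.eq (innerSL_apply_norm ℝ v)

theorem affineInner_add (y : P) (u v : V) :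
    affineInner y (u + v) = affineInner y u + affineInner y v := by
  ext x
  simp [affineInner_apply, inner_add_left]

theorem affineInner_smul (y : P) (c : ℝ) (v : V) :
    affineInner y (c • v) = c • affineInner y v := by
  ext x
  simp [affineInner_apply, inner_smul_left]

theorem eq_const_add_affineInner [CompleteSpace V] (f : P →ᴬ[ℝ] ℝ) (y : P) :
    f = ContinuousAffineMap.const ℝ P (f y)
      + affineInner y ((InnerProductSpace.toDual ℝ V).symm f.contLinear) := by
  ext x
  rw [ContinuousAffineMap.add_apply, affineInner_apply, InnerProductSpace.toDual_symm_apply,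
    ContinuousAffineMap.contLinear_map_vsub]
  simp

end AffineInner

theorem ae_eq_const_of_map_eq_dirac {X : Type*} [MeasurableSpace X] {p : Measure X} {F : X → ℝ}
    (hF : AEMeasurable F p) {c : ℝ} (h : p.map F = Measure.dirac c) : F =ᵐ[p] fun _ => c := by
  refine ae_of_ae_map (p := fun z => z = c) hF ?_
  rw [h, ae_dirac_eq]
  rfl

theorem exists_measurableSet_iSup_comap_ae_eq {X ι κ : Type*} [MeasurableSpace X]
    {p : Measure X} {F : ι → X → ℝ} {W : κ → X → ℝ}
    (h : ∀ i, ∃ k, ∃ φ : ℝ → ℝ, Measurable φ ∧ F i =ᵐ[p] φ ∘ W k) {S : Set X}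
    (hS : MeasurableSet[⨆ i, MeasurableSpace.comap (F i) inferInstance] S) :
    ∃ S', MeasurableSet[⨆ k, MeasurableSpace.comap (W k) inferInstance] S' ∧ S =ᵐ[p] S' := by
  suffices hle : (⨆ i, MeasurableSpace.comap (F i) inferInstance)
      ≤ eventuallyMeasurableSpace (⨆ k, MeasurableSpace.comap (W k) inferInstance) (ae p) from
    hle _ hS
  refine iSup_le fun i => ?_
  rintro _ ⟨B, hB, rfl⟩
  obtain ⟨k, φ, hφ, hF⟩ := h i
  exact ⟨φ ∘ W k ⁻¹' B, le_iSup (fun k => MeasurableSpace.comap (W k) inferInstance) k _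
    ⟨φ ⁻¹' B, hφ hB, rfl⟩, hF.preimage B⟩

theorem IsGaussianDensity.exists_isIsonormal {V P X : Type*} [NormedAddCommGroup V]
    [InnerProductSpace ℝ V] [CompleteSpace V] [MetricSpace P] [NormedAddTorsor V P]
    [MeasurableSpace X] {m : P → Measure X} (hm : IsGaussianDensity m) (y : P) :
    ∃ W : V → X → ℝ, IsIsonormal W (m y) ∧ ∀ a, m a = shiftMeasure W (m y) (a -ᵥ y) := by
  obtain ⟨hat, measurable_hat, hat_add, hat_smul, hat_law, hat_generates⟩ := hm.exists_hat
  have law (v : V) (a : P) :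
      (m a).map (hat (affineInner y v)) = gaussianReal ⟪v, a -ᵥ y⟫ (‖v‖₊ ^ 2) := by
    rw [hat_law, nnnorm_contLinear_affineInner, affineInner_apply]
  have hat_const (c : ℝ) : hat (ContinuousAffineMap.const ℝ P c) =ᵐ[m y] fun _ => c := by
    refine ae_eq_const_of_map_eq_dirac (measurable_hat _).aemeasurable ?_
    simp [hat_law]
  have hat_ae (f : P →ᴬ[ℝ] ℝ) : ∃ v, ∃ φ : ℝ → ℝ, Measurable φ ∧
      hat f =ᵐ[m y] φ ∘ hat (affineInner y v) := by
    refine ⟨(InnerProductSpace.toDual ℝ V).symm f.contLinear, (f y + ·),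
      measurable_const_add _, ?_⟩
    conv_lhs => rw [eq_const_add_affineInner f y]
    filter_upwards [hat_add (.const ℝ P (f y)) (affineInner y _) y, hat_const (f y)]
      with ω add_ω const_ω
    rw [add_ω, Pi.add_apply, const_ω, Function.comp_apply]
  have isonormal : IsIsonormal (fun v => hat (affineInner y v)) (m y) :=
    { measurable := fun v => measurable_hat _
      add_ae := fun u v => by
        rw [affineInner_add]
        exact hat_add _ _ _
      smul_ae := fun c v => by
        rw [affineInner_smul]
        exact hat_smul _ _ _
      law := fun v => by rw [law, vsub_self, inner_zero_right]
      generates := fun S hS => by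
        obtain ⟨S', hS', hSS'⟩ := hat_generates S hS
        obtain ⟨S'', hS'', hS'S''⟩ := exists_measurableSet_iSup_comap_ae_eq hat_ae hS'
        exact ⟨S'', hS'', (hSS' y).trans hS'S''⟩ }
  have := hm.prob
  exact ⟨_, isonormal, fun a => isonormal.eq_shiftMeasure (hm.equiv a y) _ fun u => law u a⟩

theorem IsGaussianAction.exists_hasSpectralRadius {G V P X : Type*} [Group G] [TopologicalSpace G]
    [MeasurableSpace G] [OpensMeasurableSpace G] [MeasurableMul₂ G] [MeasurableInv G]
    [NormedAddCommGroup V] [InnerProductSpace ℝ V] [CompleteSpace V] [MetricSpace P]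
    [NormedAddTorsor V P] [MeasurableSpace X] {β : AffineIsometricAction G P} {m : P → Measure X}
    {y : P} [IsProbabilityMeasure (m y)] {A : NonsingularAction G X (m y)}
    (hA : IsGaussianAction β m A) (hm : IsGaussianDensity m) {μ : Measure G}
    [IsProbabilityMeasure μ] (hμ : μ.map (fun g => g⁻¹) = μ) :
    ∃ r, HasSpectralRadius A.koopman μ r ∧ ∀ x : P,
      (∀ n, walkLaplace μ (fun g => ‖β.cocycle x g‖) n (1 / 8) ≤ r ^ n) ∧
      Tendsto (fun n : ℕ => walkLaplace μ (fun g => ‖β.cocycle x g‖) n (1 / 8) ^ (1 / (n : ℝ)))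
        atTop (𝓝 r) := by
  obtain ⟨W, isonormal, eq_shift⟩ := hm.exists_isIsonormal y
  refine (isonormal.isGaussianKernel y).exists_hasSpectralRadius (fun g a => ?_) hμ
  refine isonormal.koopman_halfDensityLp A g ?_
  rw [← eq_shift, ← eq_shift]
  exact hA g a

/-! ### Existence of isonormal processes -/

theorem countable_of_orthonormal {ι V : Type*} [NormedAddCommGroup V] [InnerProductSpace ℝ V]
    [TopologicalSpace.SeparableSpace V] {e : ι → V} (he : Orthonormal ℝ e) : Countable ι := by
  refine Pairwise.countable_of_isOpen_disjoint (s := fun i => Metric.ball (e i) (1 / 2))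
    (fun i j hij => Metric.ball_disjoint_ball ?_) (fun i => Metric.isOpen_ball)
    fun i => ⟨e i, by simp⟩
  have dist_sq : dist (e i) (e j) ^ 2 = 2 := by
    rw [dist_eq_norm, norm_sub_sq_real, he.1, he.1, he.2 hij]
    norm_num
  nlinarith [dist_nonneg (x := e i) (y := e j)]

theorem exists_hilbertBasis_nat (V : Type*) [NormedAddCommGroup V] [InnerProductSpace ℝ V]
    [CompleteSpace V] [TopologicalSpace.SeparableSpace V] :
    ∃ I : Set ℕ, Nonempty (HilbertBasis I ℝ V) := by
  obtain ⟨s, b, -⟩ := exists_hilbertBasis ℝ V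
  have := countable_of_orthonormal b.orthonormal
  obtain ⟨f, hf⟩ := exists_injective_nat s
  let E := Equiv.ofInjective f hf
  refine ⟨Set.range f, ⟨HilbertBasis.mk (v := b ∘ E.symm)
    (b.orthonormal.comp _ E.symm.injective) ?_⟩⟩
  rw [E.symm.surjective.range_comp, b.dense_span]

theorem exists_linearIsometry_apply_hilbertBasis {ι V E : Type*} [NormedAddCommGroup V]
    [InnerProductSpace ℝ V] [NormedAddCommGroup E] [InnerProductSpace ℝ E] [CompleteSpace E]
    (b : HilbertBasis ι ℝ V) {e : ι → E} (he : Orthonormal ℝ e) :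
    ∃ J : V →ₗᵢ[ℝ] E, ∀ i, J (b i) = e i := by
  classical
  refine ⟨he.orthogonalFamily.linearIsometry.comp b.repr.toLinearIsometry, fun i => ?_⟩
  change he.orthogonalFamily.linearIsometry (b.repr (b i)) = e i
  rw [b.repr_self, OrthogonalFamily.linearIsometry_apply_single]
  simp

theorem map_finsetSum_eq_gaussianReal {Ω I : Type*} [MeasurableSpace Ω] {P : Measure Ω}
    {Y : I → Ω → ℝ} (hindep : iIndepFun Y P) (hmeas : ∀ i, Measurable (Y i)) {a : I → ℝ}
    {σ : I → ℝ≥0} (hlaw : ∀ i, P.map (Y i) = gaussianReal (a i) (σ i)) (s : Finset I) :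
    P.map (∑ i ∈ s, Y i) = gaussianReal (∑ i ∈ s, a i) (∑ i ∈ s, σ i) := by
  classical
  have := hindep.isProbabilityMeasure
  induction s using Finset.induction_on with
  | empty =>
    simp only [Finset.sum_empty, gaussianReal_zero_var]
    exact (Measure.map_const P 0).trans (by simp)
  | insert i s hi ih =>
    simp only [Finset.sum_insert hi]
    exact gaussianReal_add_gaussianReal_of_indepFun
      (hindep.indepFun_finsetSum_of_notMem hmeas hi).symm (hlaw i) ih

theorem eLpNorm_two_of_map_eq_gaussianReal {X : Type*} [MeasurableSpace X] {p : Measure X}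
    {Y : X → ℝ} (hY : AEMeasurable Y p) {r : ℝ≥0} (h : p.map Y = gaussianReal 0 (r ^ 2)) :
    eLpNorm Y 2 p = r := by
  have second_moment : ∫ x, x ^ 2 ∂gaussianReal 0 (r ^ 2) = (r : ℝ) ^ 2 := by
    have variance_eq := variance_fun_id_gaussianReal (μ := 0) (v := r ^ 2)
    rw [variance_eq_integral (by fun_prop)] at variance_eq
    simpa [integral_id_gaussianReal] using variance_eq
  have eLpNorm_eq : eLpNorm Y 2 p = eLpNorm id 2 (gaussianReal 0 (r ^ 2)) := by
    rw [← h, eLpNorm_map_measure (by fun_prop) hY, Function.id_comp]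
  have memLp_id : MemLp id 2 (gaussianReal 0 (r ^ 2)) := memLp_id_gaussianReal 2
  rw [eLpNorm_eq, memLp_id.eLpNorm_eq_integral_rpow_norm (by norm_num) (by norm_num)]
  simp only [ENNReal.toReal_ofNat, Real.rpow_two, id, Real.norm_eq_abs, sq_abs, second_moment]
  rw [← one_div, ← Real.sqrt_eq_rpow, Real.sqrt_sq r.coe_nonneg, ENNReal.ofReal_coe_nnreal]

theorem continuous_charFun_map {X : Type*} [MeasurableSpace X] {p : Measure X}
    [IsProbabilityMeasure p] (t : ℝ) : Continuous fun F : Lp ℝ 2 p => charFun (p.map F) t := by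
  refine continuous_iff_seqContinuous.2 fun u F hu => ?_
  have in_distribution : TendstoInDistribution (fun n => (u n : X → ℝ)) atTop F (fun _ => p) p :=
    (tendstoInMeasure_of_tendsto_Lp hu).tendstoInDistribution
      fun n => (Lp.aestronglyMeasurable (u n)).aemeasurable
  exact ProbabilityMeasure.tendsto_iff_tendsto_charFun.1 in_distribution.tendsto t

theorem isClosed_setOf_map_eq_gaussianReal {V X : Type*} [NormedAddCommGroup V] [NormedSpace ℝ V]
    [MeasurableSpace X] {p : Measure X} [IsProbabilityMeasure p] (J : V →L[ℝ] Lp ℝ 2 p) :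
    IsClosed {v | p.map (J v) = gaussianReal 0 (‖v‖₊ ^ 2)} := by
  have charFun_iff (v : V) : p.map (J v) = gaussianReal 0 (‖v‖₊ ^ 2) ↔
      ∀ t, charFun (p.map (J v)) t = Complex.exp (-(‖v‖ ^ 2 * t ^ 2 / 2 : ℝ)) := by
    have charFun_gaussian (t : ℝ) : charFun (gaussianReal 0 (‖v‖₊ ^ 2)) t
        = Complex.exp (-(‖v‖ ^ 2 * t ^ 2 / 2 : ℝ)) := by
      simp [charFun_gaussianReal]
    refine ⟨fun h t => by rw [h, charFun_gaussian], fun h => ?_⟩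
    have : IsProbabilityMeasure (p.map (J v)) :=
      Measure.isProbabilityMeasure_map (Lp.aestronglyMeasurable (J v)).aemeasurable
    exact Measure.ext_of_charFun (funext fun t => (h t).trans (charFun_gaussian t).symm)
  simp only [charFun_iff, Set.ofPred_forall]
  exact isClosed_iInter fun t =>
    isClosed_eq ((continuous_charFun_map t).comp J.continuous) (by fun_prop)

/-- The law on `I → ℝ` under which the coordinates are independent standard Gaussian variables. -/
noncomputable abbrev stdGaussianPi (I : Type*) : Measure (I → ℝ) :=
  Measure.infinitePi fun _ : I => gaussianReal 0 1

section StdGaussianPi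

variable {I : Type*}

theorem map_eval_stdGaussianPi (i : I) :
    (stdGaussianPi I).map (fun ω => ω i) = gaussianReal 0 1 :=
  Measure.infinitePi_map_eval (fun _ : I => gaussianReal 0 1) i

theorem memLp_eval_stdGaussianPi (i : I) : MemLp (fun ω : I → ℝ => ω i) 2 (stdGaussianPi I) := by
  have memLp_id : MemLp id 2 (gaussianReal 0 1) := memLp_id_gaussianReal 2
  rw [← map_eval_stdGaussianPi i] at memLp_id
  exact (memLp_map_measure_iff memLp_id.1 (measurable_pi_apply i).aemeasurable).1 memLp_id

theorem integral_eval_stdGaussianPi (i : I) : ∫ ω, ω i ∂stdGaussianPi I = 0 := by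
  have integral_id := integral_id_gaussianReal (μ := 0) (v := 1)
  rwa [← map_eval_stdGaussianPi i, integral_map (measurable_pi_apply i).aemeasurable (by fun_prop)]
    at integral_id

theorem orthonormal_eval_stdGaussianPi :
    Orthonormal ℝ fun i : I => (memLp_eval_stdGaussianPi i).toLp _ := by
  constructor
  · intro i
    rw [Lp.norm_toLp, eLpNorm_two_of_map_eq_gaussianReal (r := 1)
      (measurable_pi_apply i).aemeasurable (by rw [map_eval_stdGaussianPi, one_pow])]
    simp
  · intro i j hij
    have indep : IndepFun (fun ω : I → ℝ => ω i) (fun ω => ω j) (stdGaussianPi I) :=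
      (iIndepFun_infinitePi (X := fun _ x => x) fun _ => measurable_id).indepFun hij
    have inner_ae : (fun ω => ⟪(memLp_eval_stdGaussianPi i).toLp _ ω,
        (memLp_eval_stdGaussianPi j).toLp _ ω⟫) =ᵐ[stdGaussianPi I] fun ω => ω i * ω j := by
      filter_upwards [(memLp_eval_stdGaussianPi i).coeFn_toLp,
        (memLp_eval_stdGaussianPi j).coeFn_toLp] with ω eval_i eval_j
      rw [eval_i, eval_j, real_inner_eq_re_inner, RCLike.inner_apply', conj_trivial,
        RCLike.re_to_real]
    rw [L2.inner_def, integral_congr_ae inner_ae, indep.integral_fun_mul_eq_mul_integral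
      (measurable_pi_apply i).aestronglyMeasurable (measurable_pi_apply j).aestronglyMeasurable,
      integral_eval_stdGaussianPi, zero_mul]

theorem map_sum_eval_stdGaussianPi (s : Finset I) (c : I → ℝ) :
    (stdGaussianPi I).map (fun ω => ∑ i ∈ s, c i * ω i) = gaussianReal 0 (∑ i ∈ s, ‖c i‖₊ ^ 2) := by
  have indep : iIndepFun (fun (i : I) (ω : I → ℝ) => c i * ω i) (stdGaussianPi I) :=
    iIndepFun_infinitePi (X := fun i x => c i * x) fun _ => measurable_const_mul _
  have law (i : I) :
      (stdGaussianPi I).map (fun ω => c i * ω i) = gaussianReal 0 (‖c i‖₊ ^ 2) := by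
    rw [← Function.comp_def (fun x => c i * x) (fun ω : I → ℝ => ω i),
      ← Measure.map_map (by fun_prop) (by fun_prop), map_eval_stdGaussianPi,
      gaussianReal_map_const_mul, mul_zero, mul_one]
    congr 1
    ext
    simp
  have sum_law := map_finsetSum_eq_gaussianReal indep (fun i => by fun_prop) law s
  rwa [Finset.sum_const_zero, Finset.sum_fn] at sum_law

end StdGaussianPi

section Isometry

variable {I V : Type*} [NormedAddCommGroup V] [InnerProductSpace ℝ V]
  {J : V →ₗᵢ[ℝ] Lp ℝ 2 (stdGaussianPi I)} {b : HilbertBasis I ℝ V}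

theorem linearIsometry_sum_ae_eq (hJ : ∀ i, J (b i) =ᵐ[stdGaussianPi I] fun ω => ω i)
    (s : Finset I) (c : I → ℝ) :
    J (∑ i ∈ s, c i • b i) =ᵐ[stdGaussianPi I] fun ω => ∑ i ∈ s, c i * ω i := by
  classical
  induction s using Finset.induction_on with
  | empty =>
    simp only [Finset.sum_empty, map_zero]
    exact Lp.coeFn_zero _ _ _
  | insert i s hi ih =>
    simp only [Finset.sum_insert hi, map_add, map_smul]
    filter_upwards [Lp.coeFn_add (c i • J (b i)) (J (∑ i ∈ s, c i • b i)),
      Lp.coeFn_smul (c i) (J (b i)), hJ i, ih] with ω add_ω smul_ω eval_ω sum_ω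
    rw [add_ω, Pi.add_apply, smul_ω, Pi.smul_apply, eval_ω, sum_ω, smul_eq_mul]

theorem map_linearIsometry_eq_gaussianReal (hJ : ∀ i, J (b i) =ᵐ[stdGaussianPi I] fun ω => ω i)
    (v : V) : (stdGaussianPi I).map (J v) = gaussianReal 0 (‖v‖₊ ^ 2) := by
  suffices span_subset : (Submodule.span ℝ (Set.range b) : Set V)
      ⊆ {v | (stdGaussianPi I).map (J v) = gaussianReal 0 (‖v‖₊ ^ 2)} from
    closure_minimal span_subset
      (isClosed_setOf_map_eq_gaussianReal J.toContinuousLinearMap)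
      (Submodule.dense_iff_topologicalClosure_eq_top.2 b.dense_span v)
  intro u hu
  obtain ⟨c, rfl⟩ := Finsupp.mem_span_range_iff_exists_finsupp.1 hu
  rw [Set.mem_ofPred, Finsupp.sum, Measure.map_congr (linearIsometry_sum_ae_eq hJ _ _),
    map_sum_eval_stdGaussianPi]
  congr 1
  refine NNReal.eq ?_
  push_cast
  rw [← real_inner_self_eq_norm_sq, b.orthonormal.inner_sum]
  simp [sq]

theorem isIsonormal_linearIsometry [Countable I]
    (hJ : ∀ i, J (b i) =ᵐ[stdGaussianPi I] fun ω => ω i) :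
    IsIsonormal (fun v => (J v : (I → ℝ) → ℝ)) (stdGaussianPi I) where
  measurable v := (Lp.stronglyMeasurable (J v)).measurable
  add_ae u v := by
    simp only [map_add]
    exact Lp.coeFn_add _ _
  smul_ae c v := by
    simp only [map_smul]
    exact Lp.coeFn_smul _ _
  law := map_linearIsometry_eq_gaussianReal hJ
  generates S hS := by
    refine ⟨(fun ω i => J (b i) ω) ⁻¹' S, ?_, ?_⟩
    · refine (@measurable_pi_iff _ _ _ (_) _ _).2 (fun i => ?_) hS
      exact measurable_iff_comap_le.2
        (le_iSup (fun v => MeasurableSpace.comap (J v) inferInstance) (b i))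
    · have eval_ae : (fun ω i => J (b i) ω) =ᵐ[stdGaussianPi I] id := by
        filter_upwards [ae_all_iff.2 hJ] with ω eval_ω
        exact funext eval_ω
      exact (eval_ae.preimage S).symm

end Isometry

/-- An isonormal process on `I → ℝ` whose values at the total family `e` are the coordinates, so
that a transformation of `I → ℝ` is determined by its effect on the process. -/
structure IsCoordinateIsonormal {I V : Type*} [NormedAddCommGroup V] [InnerProductSpace ℝ V]
    (W : V → (I → ℝ) → ℝ) (p : Measure (I → ℝ)) (e : I → V) : Prop extends IsIsonormal W p where
  dense_span : Dense (Submodule.span ℝ (Set.range e) : Set V)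
  eval_ae : ∀ i, W (e i) =ᵐ[p] fun ω => ω i

theorem exists_isCoordinateIsonormal (V : Type*) [NormedAddCommGroup V] [InnerProductSpace ℝ V]
    [CompleteSpace V] [TopologicalSpace.SeparableSpace V] :
    ∃ (I : Set ℕ) (e : I → V) (p : Measure (I → ℝ)) (W : V → (I → ℝ) → ℝ),
      IsCoordinateIsonormal W p e := by
  obtain ⟨I, ⟨b⟩⟩ := exists_hilbertBasis_nat V
  obtain ⟨J, hJ⟩ :=
    exists_linearIsometry_apply_hilbertBasis b (orthonormal_eval_stdGaussianPi (I := I))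
  have eval_ae (i : I) : J (b i) =ᵐ[stdGaussianPi I] fun ω => ω i := by
    rw [hJ]
    exact (memLp_eval_stdGaussianPi i).coeFn_toLp
  exact ⟨I, b, stdGaussianPi I, fun v => J v,
    { isIsonormal_linearIsometry eval_ae with
      dense_span := Submodule.dense_iff_topologicalClosure_eq_top.2 b.dense_span
      eval_ae := eval_ae }⟩

/-! ### Point realizations of affine isometries -/

theorem ae_eq_zero_of_forall_mem_dense {V X : Type*} [SeminormedAddCommGroup V]
    [MeasurableSpace X] {p : Measure X} {Z : V → X → ℝ} {q : ℝ≥0∞} (hq : q ≠ 0)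
    (hmeas : ∀ v, AEStronglyMeasurable (Z v) p) (hadd : ∀ u v, Z (u + v) =ᵐ[p] Z u + Z v)
    {C : ℝ≥0} (hC : ∀ v, eLpNorm (Z v) q p ≤ C * ‖v‖ₑ) {D : Set V} (hD : Dense D)
    (hZ : ∀ u ∈ D, Z u =ᵐ[p] 0) (v : V) : Z v =ᵐ[p] 0 := by
  suffices subset : D ⊆ {u | eLpNorm (Z v) q p ≤ C * ‖v - u‖ₑ} by
    have closed : IsClosed {u | eLpNorm (Z v) q p ≤ C * ‖v - u‖ₑ} :=
      isClosed_le continuous_const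
        ((ENNReal.continuous_const_mul ENNReal.coe_ne_top).comp (by fun_prop))
    have norm_le : eLpNorm (Z v) q p ≤ C * ‖v - v‖ₑ := closure_minimal subset closed (hD v)
    rw [← eLpNorm_eq_zero_iff (hmeas v) hq]
    simpa only [sub_self, enorm_eq_nnnorm, nnnorm_zero, ENNReal.coe_zero, mul_zero,
      nonpos_iff_eq_zero] using norm_le
  intro u hu
  have ae_eq : Z v =ᵐ[p] Z (v - u) := by
    have add_ae := hadd (v - u) u
    rw [sub_add_cancel] at add_ae
    filter_upwards [add_ae, hZ u hu] with x add_x zero_x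
    rw [add_x, Pi.add_apply, zero_x, Pi.zero_apply, add_zero]
  rw [Set.mem_ofPred, eLpNorm_congr_ae ae_eq]
  exact hC (v - u)

theorem IsIsonormal.map_add_const {V X : Type*} [NormedAddCommGroup V] [InnerProductSpace ℝ V]
    [MeasurableSpace X] {W : V → X → ℝ} {p : Measure X} (h : IsIsonormal W p) (v : V) (c : ℝ)
    {q : Measure X} {a : ℝ} {σ : ℝ≥0} (hq : q.map (W v) = gaussianReal a σ) :
    q.map (fun ω => W v ω + c) = gaussianReal (a + c) σ := by
  rw [← Function.comp_def (fun x => x + c) (W v), ← Measure.map_map (by fun_prop) (h.measurable v),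
    hq, gaussianReal_map_add_const]

/-- The transformation of `I → ℝ` which realizes the affine isometry with linear part `L` and
translation part `b` for a coordinate process: it turns `W v` into `W (L⁻¹ v) + ⟪v, b⟫`, and is
given by this formula in the coordinates `W (e i)`. -/
noncomputable def affineRealization {V I : Type*} [NormedAddCommGroup V] [InnerProductSpace ℝ V]
    (W : V → (I → ℝ) → ℝ) (e : I → V) (L : V ≃ₗᵢ[ℝ] V) (b : V) (ω : I → ℝ) (i : I) : ℝ :=
  W (L.symm (e i)) ω + ⟪e i, b⟫

namespace IsCoordinateIsonormal

variable {V I : Type*} [NormedAddCommGroup V] [InnerProductSpace ℝ V]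
  {W : V → (I → ℝ) → ℝ} {p : Measure (I → ℝ)} {e : I → V}

theorem measurable_affineRealization (h : IsCoordinateIsonormal W p e) (L : V ≃ₗᵢ[ℝ] V) (b : V) :
    Measurable (affineRealization W e L b) :=
  measurable_pi_lambda _ fun _ => (h.measurable _).add_const _

theorem sum_eval_ae (h : IsCoordinateIsonormal W p e) (s : Finset I) (c : I → ℝ) :
    (fun ω => ∑ i ∈ s, c i * ω i) =ᵐ[p] W (∑ i ∈ s, c i • e i) := by
  refine EventuallyEq.trans ?_ (h.sum_ae s c e)
  filter_upwards [(Finset.eventually_all s).2 fun i _ => h.eval_ae i] with ω eval_ω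
  exact Finset.sum_congr rfl fun i hi => by rw [eval_ω i hi]

theorem sum_affineRealization_ae (h : IsCoordinateIsonormal W p e) (L : V ≃ₗᵢ[ℝ] V) (b : V)
    (s : Finset I) (c : I → ℝ) :
    (fun ω => ∑ i ∈ s, c i * affineRealization W e L b ω i) =ᵐ[p]
      fun ω => W (L.symm (∑ i ∈ s, c i • e i)) ω + ⟪∑ i ∈ s, c i • e i, b⟫ := by
  filter_upwards [h.sum_ae s c fun i => L.symm (e i)] with ω sum_ω
  simp only [affineRealization, mul_add, Finset.sum_add_distrib, map_sum, map_smul, sum_ω,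
    sum_inner, real_inner_smul_left]

theorem map_affineRealization (h : IsCoordinateIsonormal W p e) (L : V ≃ₗᵢ[ℝ] V) (b : V) :
    p.map (affineRealization W e L b) = shiftMeasure W p b := by
  have := h.isProbabilityMeasure
  have := h.isProbabilityMeasure_shiftMeasure b
  have meas := h.measurable_affineRealization L b
  have map_eval := map_pi_eq_of_map_sum_eq (μ := p.map (affineRealization W e L b))
    (ν := shiftMeasure W p b) (Y := fun i (ω : I → ℝ) => ω i) (fun i => measurable_pi_apply i)
    fun s c => by
      have meas_sum : Measurable fun ω : I → ℝ => ∑ i ∈ s, c i * ω i :=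
        Finset.measurable_fun_sum _ fun _ _ => (measurable_pi_apply _).const_mul _
      rw [Measure.map_map meas_sum meas, Measure.map_congr
        ((shiftMeasure_absolutelyContinuous W p b).ae_le (h.sum_eval_ae s c)),
        h.map_shiftMeasure, Function.comp_def,
        Measure.map_congr (h.sum_affineRealization_ae L b s c),
        h.map_add_const _ _ (h.law _), zero_add, LinearIsometryEquiv.nnnorm_map]
  simpa using map_eval

theorem quasiMeasurePreserving_affineRealization (h : IsCoordinateIsonormal W p e)
    (L : V ≃ₗᵢ[ℝ] V) (b : V) :
    Measure.QuasiMeasurePreserving (affineRealization W e L b) p p :=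
  ⟨h.measurable_affineRealization L b, by
    rw [h.map_affineRealization]
    exact shiftMeasure_absolutelyContinuous W p b⟩

theorem map_comp_affineRealization (h : IsCoordinateIsonormal W p e) (L : V ≃ₗᵢ[ℝ] V) (b v : V) :
    p.map (fun ω => W v (affineRealization W e L b ω)) = gaussianReal ⟪v, b⟫ (‖v‖₊ ^ 2) := by
  rw [← h.map_shiftMeasure v b, ← h.map_affineRealization L b,
    Measure.map_map (h.measurable v) (h.measurable_affineRealization L b), Function.comp_def]

theorem eLpNorm_comp_affineRealization_sub_le (h : IsCoordinateIsonormal W p e) (L : V ≃ₗᵢ[ℝ] V)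
    (b v : V) :
    eLpNorm (fun ω => W v (affineRealization W e L b ω) - (W (L.symm v) ω + ⟪v, b⟫)) 2 p
      ≤ (2 : ℝ≥0) * ‖v‖ₑ := by
  have meas : Measurable fun ω => W v (affineRealization W e L b ω) :=
    (h.measurable v).comp (h.measurable_affineRealization L b)
  have meas_left : Measurable fun ω => W v (affineRealization W e L b ω) - ⟪v, b⟫ :=
    meas.sub_const _
  have law_left : p.map (fun ω => W v (affineRealization W e L b ω) - ⟪v, b⟫)
      = gaussianReal 0 (‖v‖₊ ^ 2) := by
    rw [← sub_self ⟪v, b⟫, ← gaussianReal_map_sub_const, ← h.map_comp_affineRealization L b v,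
      Measure.map_map (measurable_sub_const _) meas, Function.comp_def]
  have law_right := h.law (L.symm v)
  rw [LinearIsometryEquiv.nnnorm_map] at law_right
  calc eLpNorm (fun ω => W v (affineRealization W e L b ω) - (W (L.symm v) ω + ⟪v, b⟫)) 2 p
      = eLpNorm ((fun ω => W v (affineRealization W e L b ω) - ⟪v, b⟫) - W (L.symm v)) 2 p := by
        congr 1
        ext ω
        simp only [Pi.sub_apply]
        ring
    _ ≤ eLpNorm (fun ω => W v (affineRealization W e L b ω) - ⟪v, b⟫) 2 p
          + eLpNorm (W (L.symm v)) 2 p :=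
        eLpNorm_sub_le meas_left.aestronglyMeasurable (h.measurable _).aestronglyMeasurable
          one_le_two
    _ = (2 : ℝ≥0) * ‖v‖ₑ := by
        rw [eLpNorm_two_of_map_eq_gaussianReal meas_left.aemeasurable law_left,
          eLpNorm_two_of_map_eq_gaussianReal (h.measurable _).aemeasurable law_right,
          ← two_mul, ENNReal.coe_ofNat, enorm_eq_nnnorm]

theorem comp_affineRealization_ae (h : IsCoordinateIsonormal W p e) (L : V ≃ₗᵢ[ℝ] V) (b v : V) :
    (fun ω => W v (affineRealization W e L b ω)) =ᵐ[p] fun ω => W (L.symm v) ω + ⟪v, b⟫ := by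
  have quasi := h.quasiMeasurePreserving_affineRealization L b
  have diff_ae : (fun ω => W v (affineRealization W e L b ω) - (W (L.symm v) ω + ⟪v, b⟫))
      =ᵐ[p] 0 := by
    refine ae_eq_zero_of_forall_mem_dense (D := (Submodule.span ℝ (Set.range e) : Set V))
      (Z := fun v ω => W v (affineRealization W e L b ω) - (W (L.symm v) ω + ⟪v, b⟫))
      two_ne_zero (fun v => ?_) (fun u v => ?_) (h.eLpNorm_comp_affineRealization_sub_le L b)
      h.dense_span (fun v hv => ?_) v
    · exact (((h.measurable v).comp quasi.measurable).sub
        ((h.measurable _).add_const _)).aestronglyMeasurable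
    · filter_upwards [quasi.ae (h.add_ae u v), h.add_ae (L.symm u) (L.symm v)] with ω add_ω add_ω'
      simp only [Pi.add_apply, add_ω, map_add, add_ω', inner_add_left]
      ring
    · obtain ⟨c, rfl⟩ := Finsupp.mem_span_range_iff_exists_finsupp.1 hv
      rw [Finsupp.sum]
      filter_upwards [quasi.ae (h.sum_eval_ae c.support c),
        h.sum_affineRealization_ae L b c.support c] with ω eval_ω real_ω
      rw [← eval_ω, real_ω, sub_self, Pi.zero_apply]
  filter_upwards [diff_ae] with ω diff_ω
  exact sub_eq_zero.1 diff_ω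

theorem map_affineRealization_shiftMeasure (h : IsCoordinateIsonormal W p e) (L : V ≃ₗᵢ[ℝ] V)
    (b u : V) :
    (shiftMeasure W p u).map (affineRealization W e L b) = shiftMeasure W p (L u + b) := by
  have := h.isProbabilityMeasure_shiftMeasure u
  have quasi := h.quasiMeasurePreserving_affineRealization L b
  refine h.eq_shiftMeasure (((shiftMeasure_absolutelyContinuous W p u).map quasi.measurable).trans
    quasi.absolutelyContinuous) _ fun v => ?_
  rw [Measure.map_map (h.measurable v) quasi.measurable, Function.comp_def, Measure.map_congr
    ((shiftMeasure_absolutelyContinuous W p u).ae_le (h.comp_affineRealization_ae L b v)),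
    h.map_add_const _ _ (h.map_shiftMeasure _ _), LinearIsometryEquiv.nnnorm_map, inner_add_right,
    ← L.inner_map_map, L.apply_symm_apply]

theorem affineRealization_trans_ae [Countable I] (h : IsCoordinateIsonormal W p e)
    (L L' : V ≃ₗᵢ[ℝ] V) (b b' : V) :
    affineRealization W e (L'.trans L) (L b' + b) =ᵐ[p]
      fun ω => affineRealization W e L b (affineRealization W e L' b' ω) := by
  filter_upwards [ae_all_iff.2 fun i => h.comp_affineRealization_ae L' b' (L.symm (e i))]
    with ω comp_ω
  funext i
  have inner_symm : ⟪L.symm (e i), b'⟫ = ⟪e i, L b'⟫ := by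
    rw [← L.inner_map_map, L.apply_symm_apply]
  rw [affineRealization, affineRealization, comp_ω i, inner_symm, inner_add_right, add_assoc]
  rfl

theorem affineRealization_refl_ae [Countable I] (h : IsCoordinateIsonormal W p e) :
    affineRealization W e (LinearIsometryEquiv.refl ℝ V) 0 =ᵐ[p] id := by
  filter_upwards [ae_all_iff.2 h.eval_ae] with ω eval_ω
  funext i
  rw [affineRealization, inner_zero_right, add_zero]
  exact eval_ω i

end IsCoordinateIsonormal

/-! ### Gaussian actions on a given Gaussian density -/

section SquareIntegrable

variable {X : Type*} [MeasurableSpace X] {p : Measure X}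

theorem abs_setIntegral_mul_le (f k : Lp ℝ 2 p) (S : Set X) :
    |∫ ω in S, f ω * k ω ∂p| ≤ ‖f‖ * ‖k‖ := by
  have integrable : Integrable (fun ω => ‖f ω‖ * ‖k ω‖) p :=
    (Lp.memLp f).norm.integrable_mul (Lp.memLp k).norm
  have inner_ae : (fun ω => ‖f ω‖ * ‖k ω‖) =ᵐ[p] fun ω => ⟪|f| ω, |k| ω⟫ := by
    filter_upwards [Lp.coeFn_abs f, Lp.coeFn_abs k] with ω abs_f abs_k
    rw [abs_f, abs_k, real_inner_eq_re_inner, RCLike.inner_apply', conj_trivial,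
      RCLike.re_to_real, Real.norm_eq_abs, Real.norm_eq_abs]
  calc |∫ ω in S, f ω * k ω ∂p|
      ≤ ∫ ω in S, ‖f ω * k ω‖ ∂p := norm_integral_le_integral_norm fun ω => f ω * k ω
    _ = ∫ ω in S, ‖f ω‖ * ‖k ω‖ ∂p := by simp only [norm_mul]
    _ ≤ ∫ ω, ‖f ω‖ * ‖k ω‖ ∂p :=
        setIntegral_le_integral integrable (Eventually.of_forall fun ω => by positivity)
    _ = ⟪|f|, |k|⟫ := by rw [integral_congr_ae inner_ae, L2.inner_def]
    _ ≤ ‖f‖ * ‖k‖ := by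
        simpa only [norm_abs_eq_norm] using real_inner_le_norm |f| |k|

theorem abs_setIntegral_sq_sub_le (f k : Lp ℝ 2 p) (S : Set X) :
    |∫ ω in S, f ω ^ 2 ∂p - ∫ ω in S, k ω ^ 2 ∂p| ≤ ‖f - k‖ * (‖f‖ + ‖k‖) := by
  have integrable_sq (c : Lp ℝ 2 p) : IntegrableOn (fun ω => c ω ^ 2) S p :=
    (Lp.memLp c).integrable_sq.integrableOn
  have sq_sub_sq_ae : (fun ω => f ω ^ 2 - k ω ^ 2) =ᵐ[p] fun ω => (f - k) ω * (f + k) ω := by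
    filter_upwards [Lp.coeFn_sub f k, Lp.coeFn_add f k] with ω sub_ω add_ω
    rw [sub_ω, add_ω, Pi.sub_apply, Pi.add_apply, sq_sub_sq, mul_comm]
  rw [← integral_sub (integrable_sq f) (integrable_sq k),
    integral_congr_ae (ae_restrict_of_ae sq_sub_sq_ae)]
  refine (abs_setIntegral_mul_le (f - k) (f + k) S).trans ?_
  gcongr
  exact norm_add_le _ _

theorem abs_measureReal_sub_le [SigmaFinite p] {η θ : Measure X} [IsFiniteMeasure η]
    [IsFiniteMeasure θ] (hη : η ≪ p) (hθ : θ ≪ p) (S : Set X) :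
    |η.real S - θ.real S| ≤ ‖sqrtDensityLp p η - sqrtDensityLp p θ‖
      * (‖sqrtDensityLp p η‖ + ‖sqrtDensityLp p θ‖) := by
  rw [← setIntegral_sqrtDensityLp_sq p η hη, ← setIntegral_sqrtDensityLp_sq p θ hθ]
  exact abs_setIntegral_sq_sub_le _ _ S

end SquareIntegrable

/-- With the discrete topology on `G`, the continuity required of a nonsingular action is void, so
Koopman operators are available before continuity is known. -/
theorem exists_clm_sqrtDensityLp_map {G X : Type*} [Group G] [MeasurableSpace X] {p : Measure X}
    [IsProbabilityMeasure p] {act : G → X → X}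
    (quasi : ∀ g, Measure.QuasiMeasurePreserving (act g) p p)
    (one_ae : ∀ᵐ ω ∂p, act 1 ω = ω) (mul_ae : ∀ g h, ∀ᵐ ω ∂p, act (g * h) ω = act g (act h ω)) :
    ∃ U : G → Lp ℝ 2 p →L[ℝ] Lp ℝ 2 p, ∀ g (η : Measure X) [IsFiniteMeasure η], η ≪ p →
      U g (sqrtDensityLp p η) = sqrtDensityLp p (η.map (act g)) := by
  let _ : TopologicalSpace G := ⊥
  have : DiscreteTopology G := ⟨rfl⟩
  let A : NonsingularAction G X p :=
    { act := act
      quasi := quasi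
      one_ae := one_ae
      mul_ae := mul_ae
      continuous_at_one := fun η _ hη ε hε => by
        rw [nhds_discrete, eventually_pure]
        intro S _
        rw [Measure.map_congr (g := id) (hη.ae_le one_ae), Measure.map_id, sub_self, abs_zero]
        exact hε.le }
  exact ⟨A.koopman, fun g η _ hη => A.koopman_sqrtDensityLp g hη⟩

theorem IsGaussianDensity.exists_isGaussianAction {G V P X : Type*} [Group G] [TopologicalSpace G]
    [NormedAddCommGroup V] [InnerProductSpace ℝ V] [CompleteSpace V] [MetricSpace P]
    [NormedAddTorsor V P] [MeasurableSpace X] {β : AffineIsometricAction G P} {m : P → Measure X}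
    (hm : IsGaussianDensity m) (y : P) {act : G → X → X} (hact : ∀ g, Measurable (act g))
    (hmap : ∀ g x, (m x).map (act g) = m (β.hom g x)) (one_ae : ∀ᵐ ω ∂(m y), act 1 ω = ω)
    (mul_ae : ∀ g h, ∀ᵐ ω ∂(m y), act (g * h) ω = act g (act h ω)) :
    ∃ A : NonsingularAction G X (m y), IsGaussianAction β m A := by
  have := hm.prob
  have quasi (g : G) : Measure.QuasiMeasurePreserving (act g) (m y) (m y) :=
    ⟨hact g, by rw [hmap]; exact hm.equiv _ _⟩
  obtain ⟨U, hU⟩ := exists_clm_sqrtDensityLp_map quasi one_ae mul_ae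
  obtain ⟨W, hW, eq_shift⟩ := hm.exists_isIsonormal y
  have rep : IsOrthogonalRep U := (hW.isGaussianKernel y).isOrthogonalRep (β := β) fun g a => by
    have := hW.isProbabilityMeasure_shiftMeasure
    simp only [hW.halfDensityLp_eq_sqrtDensityLp, ← eq_shift, hU g (m a) (hm.equiv a y), hmap]
  refine ⟨⟨act, quasi, one_ae, mul_ae, fun η _ hη ε hε => ?_⟩, hmap⟩
  set F := sqrtDensityLp (m y) η
  have tendsto_zero : Tendsto (fun g => ‖U g F - F‖ * (‖U g F‖ + ‖F‖)) (𝓝 1) (𝓝 0) := by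
    simp only [rep.norm_map]
    simpa only [zero_mul] using (rep.tendsto_norm_sub F).mul_const (‖F‖ + ‖F‖)
  filter_upwards [tendsto_zero.eventually (gt_mem_nhds hε)] with g lt_ε S _
  refine le_trans ?_ lt_ε.le
  rw [hU g η hη]
  exact abs_measureReal_sub_le ((hη.map (hact g)).trans (quasi g).absolutelyContinuous) hη S

/-! ### Existence of Gaussian densities and Gaussian actions -/

section AffineHat

variable {V P X : Type*} [NormedAddCommGroup V] [InnerProductSpace ℝ V] [CompleteSpace V]
  [MetricSpace P] [NormedAddTorsor V P] {W : V → X → ℝ}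

/-- The random variable of the continuous affine function `f` in the Gaussian density which an
isonormal process `W` defines with basepoint `o`. -/
noncomputable def affineHat (W : V → X → ℝ) (o : P) (f : P →ᴬ[ℝ] ℝ) (ω : X) : ℝ :=
  W ((InnerProductSpace.toDual ℝ V).symm f.contLinear) ω + f o

theorem affineHat_affineInner (W : V → X → ℝ) (o : P) (v : V) :
    affineHat W o (affineInner o v) = W v := by
  have contLinear_eq : (InnerProductSpace.toDual ℝ V).symm (affineInner o v).contLinear = v := by
    rw [LinearIsometryEquiv.symm_apply_eq]
    rfl
  ext ω
  rw [affineHat, contLinear_eq, affineInner_apply, vsub_self, inner_zero_right, add_zero]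

variable [MeasurableSpace X] {p : Measure X}

theorem IsIsonormal.affineHat_add_ae (h : IsIsonormal W p) (o : P) (f k : P →ᴬ[ℝ] ℝ) :
    affineHat W o (f + k) =ᵐ[p] affineHat W o f + affineHat W o k := by
  filter_upwards [h.add_ae ((InnerProductSpace.toDual ℝ V).symm f.contLinear)
    ((InnerProductSpace.toDual ℝ V).symm k.contLinear)] with ω add_ω
  simp only [affineHat, ContinuousAffineMap.add_contLinear, map_add, add_ω, Pi.add_apply,
    ContinuousAffineMap.add_apply]
  ring

theorem IsIsonormal.affineHat_smul_ae (h : IsIsonormal W p) (o : P) (c : ℝ) (f : P →ᴬ[ℝ] ℝ) :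
    affineHat W o (c • f) =ᵐ[p] c • affineHat W o f := by
  filter_upwards [h.smul_ae c ((InnerProductSpace.toDual ℝ V).symm f.contLinear)] with ω smul_ω
  simp only [affineHat, ContinuousAffineMap.smul_contLinear, map_smulₛₗ, conj_trivial, smul_ω,
    Pi.smul_apply, ContinuousAffineMap.smul_apply, smul_eq_mul, mul_add]

theorem IsIsonormal.map_affineHat (h : IsIsonormal W p) (o : P) (f : P →ᴬ[ℝ] ℝ) (x : P) :
    (shiftMeasure W p (x -ᵥ o)).map (affineHat W o f)
      = gaussianReal (f x) (‖f.contLinear‖₊ ^ 2) := by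
  unfold affineHat
  rw [h.map_add_const _ _ (h.map_shiftMeasure _ _), InnerProductSpace.toDual_symm_apply,
    ContinuousAffineMap.contLinear_map_vsub, LinearIsometryEquiv.nnnorm_map, vsub_eq_sub,
    sub_add_cancel]

theorem IsIsonormal.isGaussianDensity (h : IsIsonormal W p) (o : P) :
    IsGaussianDensity fun x : P => shiftMeasure W p (x -ᵥ o) where
  prob x := h.isProbabilityMeasure_shiftMeasure _
  equiv x y := (shiftMeasure_absolutelyContinuous W p _).trans
    (h.absolutelyContinuous_shiftMeasure _)
  exists_hat := by
    have ae_le (x : P) : ae (shiftMeasure W p (x -ᵥ o)) ≤ ae p :=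
      (shiftMeasure_absolutelyContinuous W p (x -ᵥ o)).ae_le
    refine ⟨affineHat W o, fun f => (h.measurable _).add_const _,
      fun f k x => ae_le x (h.affineHat_add_ae o f k),
      fun c f x => ae_le x (h.affineHat_smul_ae o c f), h.map_affineHat o, fun S hS => ?_⟩
    obtain ⟨S', hS', ae_eq⟩ := h.generates S hS
    refine ⟨S', ?_, fun x => ae_le x ae_eq⟩
    have comap_le : (⨆ v, MeasurableSpace.comap (W v) inferInstance) ≤
        ⨆ f : P →ᴬ[ℝ] ℝ, MeasurableSpace.comap (affineHat W o f) inferInstance :=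
      iSup_le fun v => le_iSup_of_le (affineInner o v) (by rw [affineHat_affineInner])
    exact comap_le _ hS'

end AffineHat

theorem AffineIsometricAction.exists_isGaussianAction {G V P : Type*} [Group G]
    [TopologicalSpace G] [NormedAddCommGroup V] [InnerProductSpace ℝ V] [CompleteSpace V]
    [TopologicalSpace.SeparableSpace V] [MetricSpace P] [NormedAddTorsor V P]
    (β : AffineIsometricAction G P) :
    ∃ (X : Type) (_ : MeasurableSpace X) (_ : StandardBorelSpace X) (m : P → Measure X),
      IsGaussianDensity m ∧ ∀ y, ∃ A : NonsingularAction G X (m y), IsGaussianAction β m A := by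
  obtain ⟨I, e, p, W, hW⟩ := exists_isCoordinateIsonormal V
  have o : P := (AddTorsor.nonempty (G := V) (P := P)).some
  have hm := hW.isGaussianDensity o
  refine ⟨I → ℝ, inferInstance, inferInstance, _, hm, fun y => ?_⟩
  have hac := shiftMeasure_absolutelyContinuous W p (y -ᵥ o)
  have vsub_eq (g : G) (x : P) : β.hom g x -ᵥ o
      = (β.hom g).linearIsometryEquiv (x -ᵥ o) + (β.hom g o -ᵥ o) := by
    rw [AffineIsometricAction.linear_apply _ _ o, vsub_vadd, vsub_add_vsub_cancel]
  have linear_one : (β.hom 1).linearIsometryEquiv = LinearIsometryEquiv.refl ℝ V := by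
    rw [map_one]
    rfl
  have linear_mul (g h : G) : (β.hom (g * h)).linearIsometryEquiv
      = (β.hom h).linearIsometryEquiv.trans (β.hom g).linearIsometryEquiv := by
    rw [map_mul]
    rfl
  refine hm.exists_isGaussianAction y
    (act := fun g => affineRealization W e (β.hom g).linearIsometryEquiv (β.hom g o -ᵥ o))
    (fun g => hW.measurable_affineRealization _ _) (fun g x => ?_) (hac.ae_le ?_)
    fun g h => hac.ae_le ?_
  · rw [hW.map_affineRealization_shiftMeasure, ← vsub_eq]
  · rw [β.hom_one_apply, vsub_self, linear_one]
    exact hW.affineRealization_refl_ae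
  · rw [linear_mul, β.hom_mul_apply, vsub_eq]
    exact hW.affineRealization_trans_ae _ _ _ _

/-! ### The left regular representation -/

theorem isBigO_top_of_hasCompactSupport {X E 𝕜 : Type*} [TopologicalSpace X]
    [NormedAddCommGroup E] [NormedField 𝕜] [NormedSpace 𝕜 E] {ψ : X → E} {φ : X → 𝕜}
    (hψ : Continuous ψ) (support : HasCompactSupport ψ) (hφ : Continuous φ) (hφ0 : ∀ x, φ x ≠ 0) :
    ψ =O[⊤] φ := by
  obtain ⟨C, bound⟩ := (support.smul_left (f := fun x => (φ x)⁻¹)).exists_bound_of_continuous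
    ((hφ.inv₀ hφ0).smul hψ)
  refine Asymptotics.isBigO_top.2 ⟨C, fun x => ?_⟩
  have bound_x := bound x
  rwa [Pi.smul_apply', norm_smul, norm_inv, inv_mul_le_iff₀ (norm_pos_iff.2 (hφ0 x)), mul_comm]
    at bound_x

theorem dense_setOf_hasCompactSupport {X E : Type*} [TopologicalSpace X] [NormalSpace X] [R1Space X]
    [WeaklyLocallyCompactSpace X] [MeasurableSpace X] [BorelSpace X] {p : Measure X} [p.Regular]
    [NormedAddCommGroup E] [NormedSpace ℝ E] {q : ℝ≥0∞} [Fact (1 ≤ q)] (hq : q ≠ ∞) :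
    Dense {F : Lp E q p | ∃ f : X → E, HasCompactSupport f ∧ F =ᵐ[p] f} := by
  refine fun F => EMetric.mem_closure_iff.2 fun ε hε => ?_
  obtain ⟨δ, δ_pos, δ_lt⟩ := exists_between hε
  obtain ⟨f, support, edist_le, -, f_mem⟩ :=
    (Lp.memLp F).exists_hasCompactSupport_eLpNorm_sub_le hq δ_pos.ne'
  refine ⟨f_mem.toLp f, ⟨f, support, f_mem.coeFn_toLp⟩, ?_⟩
  nth_rewrite 1 [← Lp.toLp_coeFn F (Lp.memLp F)]
  rw [Lp.edist_toLp_toLp]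
  exact edist_le.trans_lt δ_lt

theorem le_of_forall_mul_pow_le_pow {c r R : ℝ} (hc : 0 < c) (hR : 0 ≤ R)
    (h : ∀ n : ℕ, c * r ^ n ≤ R ^ n) : r ≤ R := by
  by_contra! R_lt_r
  have r_pos : 0 < r := hR.trans_lt R_lt_r
  obtain ⟨n, pow_lt⟩ := exists_pow_lt_of_lt_one hc ((div_lt_one r_pos).2 R_lt_r)
  rw [div_pow, div_lt_iff₀ (by positivity)] at pow_lt
  exact pow_lt.not_ge (h n)

section LeftRegular

variable {G : Type*} [Group G] [TopologicalSpace G] [IsTopologicalGroup G]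
  [LocallyCompactSpace G] [SecondCountableTopology G] [MeasurableSpace G] [BorelSpace G]

theorem leftRegular_apply (g : G) (ξ : Lp ℝ 2 (Measure.haar : Measure G)) :
    leftRegular G g ξ = DomMulAct.mk g⁻¹ • ξ := rfl

theorem coeFn_leftRegular (g : G) (ξ : Lp ℝ 2 (Measure.haar : Measure G)) :
    leftRegular G g ξ =ᵐ[Measure.haar] fun h => ξ (g⁻¹ * h) :=
  Lp.coeFn_compMeasurePreserving ξ (measurePreserving_mul_left Measure.haar g⁻¹)

theorem leftRegular_mul (g h : G) (ξ : Lp ℝ 2 (Measure.haar : Measure G)) :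
    leftRegular G (g * h) ξ = leftRegular G g (leftRegular G h ξ) := by
  rw [leftRegular_apply, leftRegular_apply, leftRegular_apply, mul_inv_rev, DomMulAct.mk_mul,
    mul_smul]

theorem leftRegular_one (ξ : Lp ℝ 2 (Measure.haar : Measure G)) : leftRegular G 1 ξ = ξ := by
  rw [leftRegular_apply, inv_one, DomMulAct.mk_one, one_smul]

theorem inner_leftRegular_leftRegular (g : G) (ξ η : Lp ℝ 2 (Measure.haar : Measure G)) :
    ⟪leftRegular G g ξ, leftRegular G g η⟫ = ⟪ξ, η⟫ := by
  rw [L2.inner_def, L2.inner_def, ← integral_mul_left_eq_self (fun h => ⟪ξ h, η h⟫) g⁻¹]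
  refine integral_congr_ae ?_
  filter_upwards [coeFn_leftRegular g ξ, coeFn_leftRegular g η] with h ξ_h η_h
  rw [ξ_h, η_h]

theorem isOrthogonalRep_leftRegular : IsOrthogonalRep (leftRegular G) where
  one := leftRegular_one
  mul := leftRegular_mul
  adjoint g ξ η := by
    rw [← inner_leftRegular_leftRegular g⁻¹, ← leftRegular_mul, inv_mul_cancel, leftRegular_one]
  continuous ξ η := by
    have : Fact ((2 : ℝ≥0∞) ≠ ∞) := ⟨ENNReal.ofNat_ne_top⟩
    have continuous_orbit : Continuous fun g : G => DomMulAct.mk g⁻¹ • ξ :=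
      (DomMulAct.continuous_mk.comp continuous_inv).smul continuous_const
    exact continuous_orbit.inner continuous_const

theorem hasCompactSupport_inner_leftRegular {F : Lp ℝ 2 (Measure.haar : Measure G)} {f : G → ℝ}
    (hf : HasCompactSupport f) (hF : F =ᵐ[Measure.haar] f) :
    HasCompactSupport fun g => ⟪leftRegular G g F, F⟫ := by
  have compact : IsCompact ((fun x : G × G => x.1 * x.2⁻¹) '' (tsupport f ×ˢ tsupport f)) :=
    (hf.isCompact.prod hf.isCompact).image (by fun_prop)
  refine .intro compact fun g hg => ?_
  rw [L2.inner_def]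
  refine integral_eq_zero_of_ae ?_
  have quasi := (measurePreserving_mul_left (Measure.haar : Measure G) g⁻¹).quasiMeasurePreserving
  filter_upwards [coeFn_leftRegular g F, hF, quasi.ae hF] with h translate_h F_h F_translate
  rw [translate_h, F_h, F_translate, Pi.zero_apply]
  by_contra inner_ne
  refine hg ⟨(h, g⁻¹ * h), ⟨subset_tsupport f fun f_h => inner_ne ?_,
    subset_tsupport f fun f_translate => inner_ne ?_⟩, ?_⟩
  · rw [f_h, inner_zero_right]
  · rw [f_translate, inner_zero_left]
  · simp only [mul_inv_rev, inv_inv, mul_inv_cancel_left]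

theorem le_of_hasSpectralRadius_leftRegular {μ : Measure G} [IsProbabilityMeasure μ] {ρ : ℝ}
    (hρ : HasSpectralRadius (leftRegular G) μ ρ) (hμ : μ.map (fun g => g⁻¹) = μ) {ℓ : G → ℝ}
    (hℓ : Continuous ℓ) {s R : ℝ} (hs : 0 ≤ s) (hR : 0 ≤ R)
    (hle : ∀ n, walkLaplace μ ℓ n s ≤ R ^ n) : ρ ≤ R := by
  obtain ⟨T, hT, rfl⟩ := hρ
  refine le_of_forall_lt_imp_le_of_dense fun r hr => ?_
  rcases le_total r 0 with hr0 | hr0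
  · exact hr0.trans hR
  obtain ⟨c, hc, pow_le⟩ := isOrthogonalRep_leftRegular.exists_pow_le_integral_walkLaw hT hμ
    (dense_setOf_hasCompactSupport (by norm_num)) (φ := fun g => Real.exp (-s * ℓ g ^ 2))
    (fun n => integrable_exp_neg_mul_sq_comp hℓ.measurable.aemeasurable hs)
    (fun g => (Real.exp_pos _).le)
    (fun F ⟨f, hf, hF⟩ => isBigO_top_of_hasCompactSupport
      (isOrthogonalRep_leftRegular.continuous F F) (hasCompactSupport_inner_leftRegular hf hF)
      (by fun_prop) fun g => (Real.exp_pos _).ne') hr0 hr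
  refine (pow_le_pow_iff_left₀ hr0 hR two_ne_zero).1 ?_
  refine le_of_forall_mul_pow_le_pow hc (sq_nonneg R) fun n => ?_
  rw [← pow_mul, ← pow_mul]
  exact (pow_le n).trans ((walkLaplace_eq_integral hℓ.measurable _ s).symm.trans_le (hle _))

end LeftRegular

namespace AffineIsometricAction

variable {G V P : Type*} [Group G] [TopologicalSpace G] [NormedAddCommGroup V]
  [InnerProductSpace ℝ V] [MetricSpace P] [NormedAddTorsor V P] (α : AffineIsometricAction G P)

theorem norm_cocycle_inflate (t : {t : ℝ // 0 < t}) (x : P) (g : G) :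
    ‖(α.inflate t).cocycle ⟨x⟩ g‖ = t * ‖α.cocycle x g‖ := by
  rw [norm_cocycle, norm_cocycle]
  rfl

theorem norm_cocycle_linearPart (g : G) : ‖α.linearPart.cocycle 0 g‖ = 0 := by
  rw [norm_cocycle, dist_zero_right, norm_eq_zero]
  exact (α.hom g).linearIsometryEquiv.map_zero

variable [MeasurableSpace G] (μ : Measure G)

theorem walkLaplace_inflate (t : {t : ℝ // 0 < t}) (x : P) (n : ℕ) (s : ℝ) :
    walkLaplace μ (fun g => ‖(α.inflate t).cocycle ⟨x⟩ g‖) n s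
      = walkLaplace μ (fun g => ‖α.cocycle x g‖) n (t ^ 2 * s) := by
  simp only [walkLaplace, norm_cocycle_inflate]
  congr 2 with g
  ring_nf

variable [OpensMeasurableSpace G] [MeasurableMul₂ G] [IsProbabilityMeasure μ]

theorem exp_neg_le_walkLaplace_one (x : P) {s : ℝ} (hs : 0 ≤ s)
    (hfin : ∫⁻ g, ENNReal.ofReal (‖α.cocycle x g‖ ^ 2) ∂μ ≠ ∞) :
    Real.exp (-s * (∫⁻ g, ENNReal.ofReal (‖α.cocycle x g‖ ^ 2) ∂μ).toReal)
      ≤ walkLaplace μ (fun g => ‖α.cocycle x g‖) 1 s := by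
  have measurable_norm := α.measurable_norm_cocycle x
  have sq_nonneg_ae : 0 ≤ᵐ[μ] fun g => ‖α.cocycle x g‖ ^ 2 :=
    Eventually.of_forall fun g => sq_nonneg _
  have integrable_sq : Integrable (fun g => ‖α.cocycle x g‖ ^ 2) μ :=
    ⟨(measurable_norm.pow_const 2).aestronglyMeasurable,
      (hasFiniteIntegral_iff_ofReal sq_nonneg_ae).2 hfin.lt_top⟩
  rw [walkLaplace_eq_integral measurable_norm, walkLaw_one,
    ← integral_eq_lintegral_of_nonneg_ae sq_nonneg_ae integrable_sq.aestronglyMeasurable,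
    ← integral_const_mul]
  exact convexOn_exp.map_integral_le Real.continuous_exp.continuousOn isClosed_univ
    (Eventually.of_forall fun g => Set.mem_univ _) (integrable_sq.const_mul _)
    (integrable_exp_neg_mul_sq_comp measurable_norm.aemeasurable hs)

theorem exp_neg_harmonicSq_le {s R : ℝ} (hs : 0 ≤ s) (h : α.harmonicSq μ ≠ ∞)
    (hle : ∀ x, walkLaplace μ (fun g => ‖α.cocycle x g‖) 1 s ≤ R) :
    Real.exp (-s * (α.harmonicSq μ).toReal) ≤ R := by
  have : Nonempty P := AddTorsor.nonempty (G := V)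
  obtain ⟨u, -, tendsto_u, mem_range⟩ := exists_seq_tendsto_sInf (Set.range_nonempty
    fun x : P => ∫⁻ g, ENNReal.ofReal (‖α.cocycle x g‖ ^ 2) ∂μ) (OrderBot.bddBelow _)
  have tendsto_exp : Tendsto (fun n => Real.exp (-s * (u n).toReal)) atTop
      (𝓝 (Real.exp (-s * (α.harmonicSq μ).toReal))) :=
    (((ENNReal.tendsto_toReal h).comp tendsto_u).const_mul _).rexp
  refine le_of_tendsto tendsto_exp ?_
  filter_upwards [tendsto_u.eventually_ne h] with n u_ne_top
  obtain ⟨x, hx⟩ := mem_range n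
  rw [← hx] at u_ne_top ⊢
  exact (α.exp_neg_le_walkLaplace_one μ x hs u_ne_top).trans (hle x)

end AffineIsometricAction

/-! ### The exponential rate of the Laplace transforms -/

/-- `f s` is the limit of the `n`-th roots of `𝔼 exp (-s ℓ(g_n)²)`, for all `s ≥ 0`. -/
def IsWalkLaplaceRate {G : Type*} [Group G] [MeasurableSpace G] (μ : Measure G) (ℓ : G → ℝ)
    (f : ℝ → ℝ) : Prop :=
  ∀ s, 0 ≤ s → Tendsto (fun n : ℕ => walkLaplace μ ℓ n s ^ (1 / (n : ℝ))) atTop (𝓝 (f s))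

theorem tendsto_walkLaplace_zero {G : Type*} [Group G] [MeasurableSpace G] [MeasurableMul₂ G]
    {μ : Measure G} [IsProbabilityMeasure μ] {ℓ : G → ℝ} (hℓ : Measurable ℓ) (n : ℕ) :
    Tendsto (walkLaplace μ ℓ n) (𝓝[≥] 0) (𝓝 1) := by
  rw [← walkLaplace_zero (μ := μ) hℓ n]
  simp only [funext (walkLaplace_eq_integral (μ := μ) hℓ n)]
  refine tendsto_integral_filter_of_dominated_convergence (fun _ => 1)
    (Eventually.of_forall fun s => by fun_prop) ?_ (integrable_const 1)
    (Eventually.of_forall fun g => ?_)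
  · filter_upwards [self_mem_nhdsWithin] with s hs
    refine Eventually.of_forall fun g => ?_
    rw [Real.norm_of_nonneg (Real.exp_pos _).le]
    exact exp_neg_mul_sq_le_one hs _
  · exact (Continuous.tendsto (f := fun s => Real.exp (-s * ℓ g ^ 2)) (by fun_prop) 0).mono_left
      nhdsWithin_le_nhds

namespace IsWalkLaplaceRate

variable {G : Type*} [Group G] [MeasurableSpace G] [MeasurableMul₂ G] {μ : Measure G}
  [IsProbabilityMeasure μ] {ℓ : G → ℝ} {f : ℝ → ℝ}

theorem apply_zero (hf : IsWalkLaplaceRate μ ℓ f) (hℓ : Measurable ℓ) : f 0 = 1 := by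
  refine tendsto_nhds_unique (hf 0 le_rfl) ?_
  simp only [walkLaplace_zero hℓ, Real.one_rpow, tendsto_const_nhds]

theorem antitoneOn (hf : IsWalkLaplaceRate μ ℓ f) (hℓ : Measurable ℓ) :
    AntitoneOn f (Set.Ici 0) := fun s hs t ht hst => by
  refine le_of_tendsto_of_tendsto' (hf t ht) (hf s hs) fun n => ?_
  exact Real.rpow_le_rpow (walkLaplace_pos hℓ n ht).le
    (antitoneOn_walkLaplace hℓ n hs ht hst) (by positivity)

theorem le_one (hf : IsWalkLaplaceRate μ ℓ f) (hℓ : Measurable ℓ) {s : ℝ} (hs : 0 ≤ s) :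
    f s ≤ 1 :=
  (hf.antitoneOn hℓ Set.self_mem_Ici hs hs).trans_eq (hf.apply_zero hℓ)

theorem convexOn_log (hf : IsWalkLaplaceRate μ ℓ f) (hℓ : Measurable ℓ)
    (hpos : ∀ s, 0 ≤ s → 0 < f s) : ConvexOn ℝ (Set.Ici 0) fun s => Real.log (f s) := by
  have tendsto_log {s : ℝ} (hs : 0 ≤ s) : Tendsto
      (fun n : ℕ => (1 / (n : ℝ)) • Real.log (walkLaplace μ ℓ n s)) atTop (𝓝 (Real.log (f s))) :=
    ((hf s hs).log (hpos s hs).ne').congr fun n =>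
      Real.log_rpow (walkLaplace_pos (μ := μ) hℓ n hs) _
  refine ⟨convex_Ici 0, fun s hs t ht a b ha hb hab => ?_⟩
  refine le_of_tendsto_of_tendsto' (tendsto_log (convex_Ici 0 hs ht ha hb hab))
    (((tendsto_log hs).const_smul a).add ((tendsto_log ht).const_smul b)) fun n => ?_
  exact ((convexOn_log_walkLaplace (μ := μ) hℓ n).smul (by positivity)).2 hs ht ha hb hab

/-- Log-convexity only gives continuity on `(0, ∞)`; at `0` the rate is squeezed between the
Laplace transform of the first step and `1`. -/
theorem continuousOn (hf : IsWalkLaplaceRate μ ℓ f) (hℓ : Measurable ℓ)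
    (hle : ∀ s, 0 ≤ s → walkLaplace μ ℓ 1 s ≤ f s) : ContinuousOn f (Set.Ici 0) := by
  have hpos (s : ℝ) (hs : 0 ≤ s) : 0 < f s :=
    (walkLaplace_pos (μ := μ) hℓ 1 hs).trans_le (hle s hs)
  intro s hs
  rcases (Set.mem_Ici.1 hs).eq_or_lt with rfl | s_pos
  · rw [ContinuousWithinAt, hf.apply_zero hℓ]
    refine tendsto_of_tendsto_of_tendsto_of_le_of_le' (tendsto_walkLaplace_zero (μ := μ) hℓ 1)
      tendsto_const_nhds ?_ ?_
    · filter_upwards [self_mem_nhdsWithin] using hle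
    · filter_upwards [self_mem_nhdsWithin] with s hs using hf.le_one hℓ hs
  · have continuousOn_log := (hf.convexOn_log hℓ hpos).continuousOn_interior
    rw [interior_Ici] at continuousOn_log
    refine ((continuousOn_log.continuousAt (Ioi_mem_nhds s_pos)).rexp.congr ?_).continuousWithinAt
    filter_upwards [Ioi_mem_nhds s_pos] with t ht using Real.exp_log (hpos t (le_of_lt ht))

end IsWalkLaplaceRate

/-! ### Spectral radii of Gaussian actions -/

section SpectralRadius

variable {G V P : Type*} [Group G] [TopologicalSpace G] [MeasurableSpace G]
  [OpensMeasurableSpace G] [MeasurableMul₂ G] [MeasurableInv G] [NormedAddCommGroup V]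
  [InnerProductSpace ℝ V] [CompleteSpace V] [TopologicalSpace.SeparableSpace V] [MetricSpace P]
  [NormedAddTorsor V P] {μ : Measure G} [IsProbabilityMeasure μ]

theorem hasGaussianSpectralRadius_of_tendsto (β : AffineIsometricAction G P)
    (hμ : μ.map (fun g => g⁻¹) = μ) {x : P} {R : ℝ}
    (hR : Tendsto (fun n : ℕ => walkLaplace μ (fun g => ‖β.cocycle x g‖) n (1 / 8) ^ (1 / (n : ℝ)))
      atTop (𝓝 R)) : HasGaussianSpectralRadius.{w} β μ R := by
  refine ⟨β.exists_isGaussianAction, fun X _ _ m _ hm y A hA => ?_⟩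
  obtain ⟨r, hr, tendsto_r⟩ := hA.exists_hasSpectralRadius hm hμ
  rwa [tendsto_nhds_unique hR (tendsto_r x).2]

theorem hasGaussianSpectralRadius_linearPart (α : AffineIsometricAction G P)
    (hμ : μ.map (fun g => g⁻¹) = μ) : HasGaussianSpectralRadius.{w} α.linearPart μ 1 := by
  refine hasGaussianSpectralRadius_of_tendsto _ hμ (x := 0) ?_
  simp [walkLaplace, walkExpectation, α.norm_cocycle_linearPart]

theorem hasGaussianSpectralRadius_inflate (α : AffineIsometricAction G P)
    (hμ : μ.map (fun g => g⁻¹) = μ) {x : P} {f : ℝ → ℝ}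
    (hf : IsWalkLaplaceRate μ (fun g => ‖α.cocycle x g‖) f) (t : {t : ℝ // 0 < t}) :
    HasGaussianSpectralRadius.{w} (α.inflate t) μ (f ((t : ℝ) ^ 2 / 8)) := by
  refine hasGaussianSpectralRadius_of_tendsto _ hμ (x := ⟨x⟩) ?_
  simpa only [α.walkLaplace_inflate, mul_one_div] using hf (t ^ 2 / 8) (by positivity)

theorem exists_tendsto_walkLaplace (α : AffineIsometricAction G P)
    (hμ : μ.map (fun g => g⁻¹) = μ) {s : ℝ} (hs : 0 ≤ s) :
    ∃ R, ∀ x, (∀ n, walkLaplace μ (fun g => ‖α.cocycle x g‖) n s ≤ R ^ n) ∧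
      Tendsto (fun n : ℕ => walkLaplace μ (fun g => ‖α.cocycle x g‖) n s ^ (1 / (n : ℝ)))
        atTop (𝓝 R) := by
  rcases hs.eq_or_lt with rfl | s_pos
  · exact ⟨1, fun x => by simp [walkLaplace_zero (α.measurable_norm_cocycle x)]⟩
  let t : {t : ℝ // 0 < t} := ⟨√(8 * s), by positivity⟩
  have sq_t : (t : ℝ) ^ 2 * (1 / 8) = s := by
    rw [Real.sq_sqrt (by positivity)]
    ring
  obtain ⟨X, _, _, m, hm, exists_action⟩ := (α.inflate t).exists_isGaussianAction
  have y : Inflation t P := (AddTorsor.nonempty (G := V) (P := Inflation t P)).some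
  obtain ⟨A, hA⟩ := exists_action y
  have := hm.prob y
  obtain ⟨r, -, hr⟩ := hA.exists_hasSpectralRadius hm hμ
  exact ⟨r, fun x => by simpa only [α.walkLaplace_inflate, sq_t] using hr ⟨x⟩⟩

theorem exists_isWalkLaplaceRate (α : AffineIsometricAction G P)
    (hμ : μ.map (fun g => g⁻¹) = μ) :
    ∃ f : ℝ → ℝ, ∀ x, IsWalkLaplaceRate μ (fun g => ‖α.cocycle x g‖) f ∧
      ∀ s, 0 ≤ s → ∀ n, walkLaplace μ (fun g => ‖α.cocycle x g‖) n s ≤ f s ^ n := by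
  choose! f hf using fun s (hs : 0 ≤ s) => exists_tendsto_walkLaplace (μ := μ) α hμ hs
  exact ⟨f, fun x => ⟨fun s hs => (hf s hs x).2, fun s hs => (hf s hs x).1⟩⟩

end SpectralRadius

theorem mainTheorem8 {G V P : Type*}
    [Group G] [TopologicalSpace G] [IsTopologicalGroup G] [T2Space G] [LocallyCompactSpace G]
    [SecondCountableTopology G] [MeasurableSpace G] [BorelSpace G]
    [NormedAddCommGroup V] [InnerProductSpace ℝ V] [CompleteSpace V]
    [TopologicalSpace.SeparableSpace V] [MetricSpace P] [NormedAddTorsor V P]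
    (α : AffineIsometricAction G P) (x : P)
    (μ : Measure G) [IsProbabilityMeasure μ] (hμ : μ.map (fun g => g⁻¹) = μ) :
    ∃ f : ℝ → ℝ,
      (∀ s, 0 ≤ s →
        Tendsto
          (fun n : ℕ =>
            walkExpectation μ n (fun g => Real.exp (-s * ‖α.cocycle x g‖ ^ 2)) ^ (1 / (n : ℝ)))
          atTop (𝓝 (f s))) ∧
      (∀ s, 0 ≤ s → 0 < f s ∧ f s ≤ 1) ∧
      (HasGaussianSpectralRadius.{w} α.linearPart μ (f 0) ∧
        ∀ t : {t : ℝ // 0 < t},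
          HasGaussianSpectralRadius.{w} (α.inflate t) μ (f ((t : ℝ) ^ 2 / 8))) ∧
      (∃ ρ : ℝ, HasSpectralRadius (leftRegular G) μ ρ ∧ ∀ s, 0 ≤ s → ρ ≤ f s) ∧
      (α.harmonicSq μ ≠ ∞ →
        ∀ s, 0 ≤ s → Real.exp (-s * (α.harmonicSq μ).toReal) ≤ f s) ∧
      ContinuousOn f (Set.Ici 0) ∧
      AntitoneOn f (Set.Ici 0) ∧
      ConvexOn ℝ (Set.Ici 0) (fun s => Real.log (f s)) := by
  obtain ⟨f, hf⟩ := exists_isWalkLaplaceRate (μ := μ) α hμ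
  obtain ⟨rate, le_pow⟩ := hf x
  have hℓ := α.measurable_norm_cocycle x
  have walkLaplace_one_le (s : ℝ) (hs : 0 ≤ s) (y : P) :
      walkLaplace μ (fun g => ‖α.cocycle y g‖) 1 s ≤ f s := by
    simpa only [pow_one] using (hf y).2 s hs 1
  have hpos (s : ℝ) (hs : 0 ≤ s) : 0 < f s :=
    (walkLaplace_pos hℓ 1 hs).trans_le (walkLaplace_one_le s hs x)
  obtain ⟨T, hT⟩ := (isOrthogonalRep_leftRegular (G := G)).exists_isWeakIntegral μ
  have hρ : HasSpectralRadius (leftRegular G) μ ‖T‖ := ⟨T, hT, rfl⟩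
  refine ⟨f, rate, fun s hs => ⟨hpos s hs, rate.le_one hℓ hs⟩, ⟨?_, ?_⟩,
    ⟨‖T‖, hρ, fun s hs => ?_⟩, ?_, ?_, rate.antitoneOn hℓ, rate.convexOn_log hℓ hpos⟩
  · rw [rate.apply_zero hℓ]
    exact hasGaussianSpectralRadius_linearPart α hμ
  · exact hasGaussianSpectralRadius_inflate α hμ rate
  · exact le_of_hasSpectralRadius_leftRegular hρ hμ (α.continuous_norm_cocycle x) hs
      (hpos s hs).le (le_pow s hs)
  · exact fun harmonic_ne s hs => α.exp_neg_harmonicSq_le μ hs harmonic_ne (walkLaplace_one_le s hs)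
  · exact rate.continuousOn hℓ fun s hs => walkLaplace_one_le s hs x
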